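/- **Setting.** Let $n\in\{2,3\}$, let $\Omega\subset\mathbb R^n$ be open, bounded and convex, $\alpha,\beta>0$, $a\le 0\le b$ real, $y_d,y_r\in L^2(\Omega)$. Let $a_{ij},c_0\in L^\infty(\Omega)$ with $a_{ij}=a_{ji}$, $c_0\ge 0$ a.e. and $\sum_{i,j}a_{ij}(x)\xi_i\xi_j\ge\theta\|\xi\|^2$ for a.a. $x\in\Omega$ and all $\xi\in\mathbb R^n$, for some $\theta>0$, and put $a(y,v)=\int_\Omega\big(\sum_{i,j}a_{ji}\,y_{x_i}v_{x_j}+c_0yv\big)\,dx$. Let $\mathcal T_h$ be a conforming triangulation by finitely many nondegenerate $n$-simplices, whose union has interior $\Omega_h\subset\Omega$. Let $Y_h$ be the space of continuous functions that are affine on every cell of $\mathcal T_h$ and vanish off $\Omega_h$. Let $x_1,\dots,x_{N_h}$ be the vertices of $\mathcal T_h$ lying in $\Omega_h$ and $\phi_1,\dots,\phi_{N_h}$ the nodal basis of $Y_h$, i.e. $\phi_i\in Y_h$, $\phi_i(x_j)=\delta_{ij}$. Put $$K_h=\big(a(\phi_i,\phi_j)\big)_{i,j},\quad M_h=\Big(\int_{\Omega_h}\phi_i\phi_j\,dx\Big)_{i,j},\quad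 W_h=\mathrm{diag}\Big(\int_{\Omega_h}\phi_i\,dx\Big)_i,\quad \gamma=\begin{cases}4,&n=2,\\5,&n=3,\end{cases}$$ and let $\mathbf y_d,\mathbf y_r\in\mathbb R^{N_h}$ be the coefficient vectors of the $L^2$-projections of $y_d,y_r$ onto $Y_h$. Write $\|x\|_A^2=\langle x,Ax\rangle$, let $\delta_{[-\beta,\beta]}$ be the indicator function of $[-\beta,\beta]^{N_h}$ and $\delta^*_{[a,b]}(x)=\sup_{s\in[a,b]^{N_h}}\langle x,s\rangle$. **Problem $(\mathrm D_h)$.** Minimize over $z=(\lambda,p,\mu)\in(\mathbb R^{N_h})^3$ $$\Phi_h(z)=\tfrac12\|K_hp-M_h\mathbf y_d\|_{M_h^{-1}}^2+\tfrac1{2\alpha}\|\lambda+\mu-p\|_{M_h}^2+\langle M_h\mathbf y_r,p\rangle+\delta_{[-\beta,\beta]}(\lambda)+\delta^*_{[a,b]}(M_h\mu)-\tfrac12\|\mathbf y_d\|_{M_h}^2 .$$ **Algorithm (sGS-mABCD).** Given $z^0=(\lambda^0,p^0,\mu^0)\in(\mathbb R^{N_h})^3$, put $\tilde z^1=(\tilde\lambda^1,\tilde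 p^1,\tilde\mu^1)=z^0$, $t_1=1$, and for $k=1,2,\dots$ compute $$\begin{aligned} \hat p^k&\in\arg\min_p\ \tfrac12\|K_hp-M_h\mathbf y_d\|_{M_h^{-1}}^2+\tfrac1{2\alpha}\|p-\tilde\lambda^k-\tilde\mu^k\|_{M_h}^2+\langle M_h\mathbf y_r,p\rangle,\\ \lambda^k&\in\arg\min_\lambda\ \delta_{[-\beta,\beta]}(\lambda)+\tfrac1{2\alpha}\|\lambda-(\hat p^k-\tilde\mu^k)\|_{M_h}^2+\tfrac1{2\alpha}\|\lambda-\tilde\lambda^k\|_{W_h-M_h}^2,\\ p^k&\in\arg\min_p\ \tfrac12\|K_hp-M_h\mathbf y_d\|_{M_h^{-1}}^2+\tfrac1{2\alpha}\|p-\lambda^k-\tilde\mu^k\|_{M_h}^2+\langle M_h\mathbf y_r,p\rangle,\\ \mu^k&\in\arg\min_\mu\ \delta^*_{[a,b]}(M_h\mu)+\tfrac1{2\alpha}\|\mu-(p^k-\lambda^k)\|_{M_h}^2+\tfrac1{2\alpha}\|\mu-\tilde\mu^k\|_{\gamma M_hW_h^{-1}M_h-M_h}^2, \end{aligned}$$ and,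 with $z^k=(\lambda^k,p^k,\mu^k)$, set $t_{k+1}=\frac{1+\sqrt{1+4t_k^2}}2$ and $\tilde z^{k+1}=z^k+\frac{t_k-1}{t_{k+1}}(z^k-z^{k-1})$. **Theorem.** Let $z^*=(\lambda^*,p^*,\mu^*)$ be a solution of $(\mathrm D_h)$ and let $\{z^k\}$ be generated by the algorithm. Then $$\Phi_h(z^k)-\Phi_h(z^*)\le\frac{4\tau_h}{(k+1)^2}\qquad\text{for all }k\ge1,$$ where $\tau_h=\frac12\|z^0-z^*\|_{\mathcal S_h}^2$ and $$\mathcal S_h=\frac1\alpha\begin{pmatrix}M_h(M_h+\alpha K_hM_h^{-1}K_h)^{-1}M_h+W_h-M_h&0&0\\0&0&0\\0&0&\gamma M_hW_h^{-1}M_h\end{pmatrix}.$$ Moreover, the sequence $\{z^k\}$ is bounded. -/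

import Mathlib

open MeasureTheory Matrix Set

noncomputable section

namespace FEDual

/-- The space `ℝⁿ` with its Euclidean structure. -/
abbrev Space (n : ℕ) : Type := EuclideanSpace ℝ (Fin n)

/-- Coefficient vectors in `ℝ^N`. -/
abbrev Vec (N : ℕ) : Type := Fin N → ℝ

/-- The dual variable `z = (λ, p, μ)`, with components `z.1`, `z.2.1`, `z.2.2`. -/
abbrev Dual (N : ℕ) : Type := Vec N × Vec N × Vec N

/-! ### The elliptic operator -/

/-- The `i`-th partial derivative.  It is applied only to continuous piecewise affine functions,
which are differentiable almost everywhere and whose almost everywhere derivative is the weak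
derivative. -/
def partialDeriv {n : ℕ} (i : Fin n) (y : Space n → ℝ) (x : Space n) : ℝ :=
  fderiv ℝ y x (EuclideanSpace.single i 1)

/-- The assumptions on the coefficients of
`L y = - ∑ i j, ∂_j (A i j * ∂_i y) + c₀ * y` on `Ω`. -/
structure IsElliptic {n : ℕ} (Ω : Set (Space n)) (A : Fin n → Fin n → Space n → ℝ)
    (c₀ : Space n → ℝ) : Prop where
  memLp_A : ∀ i j, MemLp (A i j) ⊤ (volume.restrict Ω)
  memLp_c₀ : MemLp c₀ ⊤ (volume.restrict Ω)
  c₀_nonneg : ∀ᵐ x ∂(volume.restrict Ω), 0 ≤ c₀ x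
  symm : ∀ i j, ∀ᵐ x ∂(volume.restrict Ω), A i j x = A j i x
  coercive : ∃ θ : ℝ, 0 < θ ∧ ∀ᵐ x ∂(volume.restrict Ω), ∀ ξ : Space n,
    θ * ‖ξ‖ ^ 2 ≤ ∑ i, ∑ j, A i j x * ξ i * ξ j

/-- The bilinear form `a(y, v) = ∫_Ω (∑ i j, A j i * ∂_i y * ∂_j v + c₀ * y * v)`. -/
def bilinForm {n : ℕ} (Ω : Set (Space n)) (A : Fin n → Fin n → Space n → ℝ)
    (c₀ : Space n → ℝ) (y v : Space n → ℝ) : ℝ :=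
  ∫ x in Ω, ((∑ i, ∑ j, A j i x * partialDeriv i y x * partialDeriv j v x) + c₀ x * y x * v x)

/-! ### Finite elements -/

/-- `Ω_h`, the interior of the union of the cells. -/
def meshDomain {n : ℕ} (T : Geometry.SimplicialComplex ℝ (Space n)) : Set (Space n) :=
  interior T.space

/-- `T` is a conforming triangulation (finitely many nondegenerate `n`-simplices with their faces,
any two of which meet in a common face) with `Ω_h ⊆ Ω`. -/
structure IsTriangulation {n : ℕ} (Ω : Set (Space n))
    (T : Geometry.SimplicialComplex ℝ (Space n)) : Prop where
  finite : T.faces.Finite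
  pure : ∀ s ∈ T.faces, ∃ t ∈ T.faces, s ⊆ t ∧ t.card = n + 1
  subset : meshDomain T ⊆ Ω

/-- The finite element space `Y_h` (which is also `U_h`): continuous functions which are affine
on each cell and vanish off `Ω_h`.  Functions are extended by zero to the whole of `ℝⁿ`. -/
def feSpace {n : ℕ} (T : Geometry.SimplicialComplex ℝ (Space n)) : Set (Space n → ℝ) :=
  {y | Continuous y ∧
    (∀ s ∈ T.faces, ∃ g : Space n →ᵃ[ℝ] ℝ, EqOn y g (convexHull ℝ (s : Set (Space n)))) ∧
    ∀ x, x ∉ meshDomain T → y x = 0}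

/-- `node` enumerates, without repetition, the vertices of `T` lying in `Ω_h`, and `φ` is the
corresponding nodal basis of `Y_h`, i.e. `φ i ∈ Y_h` and `φ i (node j) = δ_ij`. -/
structure IsNodalBasis {n N : ℕ} (T : Geometry.SimplicialComplex ℝ (Space n))
    (node : Fin N → Space n) (φ : Fin N → Space n → ℝ) : Prop where
  injective : Function.Injective node
  range_eq : range node = T.vertices ∩ meshDomain T
  mem : ∀ i, φ i ∈ feSpace T
  apply_node : ∀ i j, φ i (node j) = if i = j then 1 else 0

/-- The stiffness matrix `K_h = (a(φ_i, φ_j))`. -/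
def stiffness {n N : ℕ} (Ω : Set (Space n)) (A : Fin n → Fin n → Space n → ℝ)
    (c₀ : Space n → ℝ) (φ : Fin N → Space n → ℝ) : Matrix (Fin N) (Fin N) ℝ :=
  Matrix.of fun i j => bilinForm Ω A c₀ (φ i) (φ j)

/-- The mass matrix `M_h = (∫_{Ω_h} φ_i φ_j)`. -/
def mass {n N : ℕ} (T : Geometry.SimplicialComplex ℝ (Space n))
    (φ : Fin N → Space n → ℝ) : Matrix (Fin N) (Fin N) ℝ :=
  Matrix.of fun i j => ∫ x in meshDomain T, φ i x * φ j x

/-- The lumped mass matrix `W_h = diag (∫_{Ω_h} φ_i)`. -/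
def lumpedMass {n N : ℕ} (T : Geometry.SimplicialComplex ℝ (Space n))
    (φ : Fin N → Space n → ℝ) : Matrix (Fin N) (Fin N) ℝ :=
  Matrix.diagonal fun i => ∫ x in meshDomain T, φ i x

/-- `c` is the coefficient vector of the `L²`-projection of `y` onto `Y_h`: the difference
`y - ∑ j, c j * φ j` is `L²(Ω)`-orthogonal to every basis function. -/
def IsProjection {n N : ℕ} (Ω : Set (Space n)) (φ : Fin N → Space n → ℝ)
    (y : Space n → ℝ) (c : Vec N) : Prop :=
  ∀ i, ∫ x in Ω, (y x - ∑ j, c j * φ j x) * φ i x = 0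

/-- The constant `γ`: `4` in dimension `2` and `5` in dimension `3`. -/
def gam (n : ℕ) : ℝ := if n = 2 then 4 else 5

/-! ### The discretized dual problem -/

/-- `‖x‖²_A = ⟨x, A x⟩`. -/
def sqNorm {ι : Type} [Fintype ι] (A : Matrix ι ι ℝ) (x : ι → ℝ) : ℝ := x ⬝ᵥ A *ᵥ x

/-- The box `[l, u]^N`. -/
def box {N : ℕ} (l u : ℝ) : Set (Vec N) := {x | ∀ i, l ≤ x i ∧ x i ≤ u}

open Classical in
/-- The indicator function `δ_C`. -/
def indic {N : ℕ} (C : Set (Vec N)) (x : Vec N) : EReal := if x ∈ C then 0 else ⊤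

/-- The conjugate `δ*_C` of the indicator function. -/
def suppFn {N : ℕ} (C : Set (Vec N)) (x : Vec N) : EReal := ⨆ s ∈ C, ((x ⬝ᵥ s : ℝ) : EReal)

/-- The objective function `Φ_h` of the discretized dual problem. -/
def dualObj {N : ℕ} (α β a b : ℝ) (K M : Matrix (Fin N) (Fin N) ℝ) (yd yr : Vec N)
    (z : Dual N) : EReal :=
  ((1 / 2 * sqNorm M⁻¹ (K *ᵥ z.2.1 - M *ᵥ yd) + 1 / (2 * α) * sqNorm M (z.1 + z.2.2 - z.2.1)
      + (M *ᵥ yr) ⬝ᵥ z.2.1 - 1 / 2 * sqNorm M yd : ℝ) : EReal)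
    + indic (box (-β) β) z.1 + suppFn (box a b) (M *ᵥ z.2.2)

/-! ### The algorithm -/

/-- The objective function of the `p`-subproblems, for given `λ` and `μ`. -/
def pObj {N : ℕ} (α : ℝ) (K M : Matrix (Fin N) (Fin N) ℝ) (yd yr lam mu p : Vec N) : ℝ :=
  1 / 2 * sqNorm M⁻¹ (K *ᵥ p - M *ᵥ yd) + 1 / (2 * α) * sqNorm M (p - lam - mu)
    + (M *ᵥ yr) ⬝ᵥ p

/-- The objective function of the `λ`-subproblem, for given `p̂`, `λ̃` and `μ̃`. -/
def lamObj {N : ℕ} (α β : ℝ) (M W : Matrix (Fin N) (Fin N) ℝ)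
    (phat lamt mt lam : Vec N) : EReal :=
  indic (box (-β) β) lam
    + ((1 / (2 * α) * sqNorm M (lam - (phat - mt))
        + 1 / (2 * α) * sqNorm (W - M) (lam - lamt) : ℝ) : EReal)

/-- The objective function of the `μ`-subproblem, for given `λ`, `p` and `μ̃`. -/
def muObj {N : ℕ} (α a b γ : ℝ) (M W : Matrix (Fin N) (Fin N) ℝ)
    (lam p mt mu : Vec N) : EReal :=
  suppFn (box a b) (M *ᵥ mu)
    + ((1 / (2 * α) * sqNorm M (mu - (p - lam))
        + 1 / (2 * α) * sqNorm (γ • (M * W⁻¹ * M) - M) (mu - mt) : ℝ) : EReal)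

/-- `z` is a sequence generated by the sGS-mABCD algorithm started at `z 0`; `zt k`, `phat k` and
`t k` are the extrapolated points `z̃ᵏ`, the auxiliary vectors `p̂ᵏ` and the numbers `t_k`. -/
def IsGenerated {N : ℕ} (α β a b γ : ℝ) (K M W : Matrix (Fin N) (Fin N) ℝ) (yd yr : Vec N)
    (z : ℕ → Dual N) : Prop :=
  ∃ (zt : ℕ → Dual N) (phat : ℕ → Vec N) (t : ℕ → ℝ),
    zt 1 = z 0 ∧ t 1 = 1 ∧
    ∀ k, 1 ≤ k →
      IsMinOn (pObj α K M yd yr (zt k).1 (zt k).2.2) univ (phat k) ∧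
      IsMinOn (lamObj α β M W (phat k) (zt k).1 (zt k).2.2) univ (z k).1 ∧
      IsMinOn (pObj α K M yd yr (z k).1 (zt k).2.2) univ (z k).2.1 ∧
      IsMinOn (muObj α a b γ M W (z k).1 (z k).2.1 (zt k).2.2) univ (z k).2.2 ∧
      t (k + 1) = (1 + √(1 + 4 * t k ^ 2)) / 2 ∧
      zt (k + 1) = z k + ((t k - 1) / t (k + 1)) • (z k - z (k - 1))

/-! ### The constant `τ_h` -/

/-- The block matrix `S_h`. -/
def shMatrix {N : ℕ} (α γ : ℝ) (K M W : Matrix (Fin N) (Fin N) ℝ) :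
    Matrix (Fin N ⊕ Fin N ⊕ Fin N) (Fin N ⊕ Fin N ⊕ Fin N) ℝ :=
  (1 / α) • Matrix.fromBlocks (M * (M + α • (K * M⁻¹ * K))⁻¹ * M + W - M) 0 0
    (Matrix.fromBlocks 0 0 0 (γ • (M * W⁻¹ * M)))

/-- The column vector `(λ; p; μ)`. -/
def stack {N : ℕ} (z : Dual N) : Fin N ⊕ Fin N ⊕ Fin N → ℝ :=
  Sum.elim z.1 (Sum.elim z.2.1 z.2.2)

/-- `τ_h = ½ ‖z⁰ - z*‖²_{S_h}`. -/
def tauh {N : ℕ} (α γ : ℝ) (K M W : Matrix (Fin N) (Fin N) ℝ) (z₀ zs : Dual N) : ℝ :=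
  1 / 2 * sqNorm (shMatrix α γ K M W) (stack (z₀ - zs))

end FEDual

end

open FEDual

set_option linter.unusedSectionVars false

/-! The p-subproblem is a strictly convex quadratic one, and solving it before and after the λ-step
has a closed form. With P = M + αKM⁻¹K, the optimality conditions give P(p - p̂) = M(λ - λ̃). So the
λ-step behaves as if it already used the final p, at the price of the extra proximal matrix MP⁻¹M.
One sweep is then a two-block proximal step in (λ, p) and μ whose proximal form is S_h. Its p-block
is zero because p is minimized exactly.

Adding the optimality conditions for p, λ and μ gives, for every w in the domain, Φ(z) + ½‖w - z‖² ≤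
Φ(w) + ½‖w - z̃‖² in the seminorm of S_h (`two_block_descent`, `sweep_three_point`). The only loss
to absorb is the coupling of μ with (λ, p), and this needs M ≤ γMW⁻¹M. From the three-point
inequality, the Nesterov weights make t_k²(Φ(z^k) - Φ(z*)) + ½‖t_k z^k - (t_k - 1)z^{k-1} - z*‖²
bounded by τ_h (`lyapunov_le`), and t_k ≥ (k+1)/2 yields the rate.

The finite element input is M ≤ W ≤ (n+2)M as quadratic forms, with n + 2 = γ. For y in Y_h, ⟨c, Wc⟩
is the integral of the nodal interpolant of y², and ⟨c, Mc⟩ that of y² itself. The first bound is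
Jensen's inequality on each cell. The second follows from the exact second moments of barycentric
coordinates, found here by bisecting the simplex (`setIntegral_halve_add`, `setIntegral_coord_mul`).
The upper bound also gives M ≤ γMW⁻¹M and the definiteness of M.

S_h does not see p, so boundedness is argued by component: λ stays in the box, μ is controlled by
the seminorm, and p is a fixed affine function of λ and the extrapolated μ. -/

namespace FEDual

/-! ### Moments of barycentric coordinates on a simplex -/

section Simplex

variable {ι E : Type*} [Fintype ι] [NormedAddCommGroup E] [NormedSpace ℝ E]
  (b : AffineBasis ι ℝ E)

/-- The affine map that moves the vertex `b j` to the midpoint of `b i` and `b j` and fixes all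
other vertices. -/
noncomputable def halve (i j : ι) (x : E) : E := x + b.coord j x • ((1 / 2 : ℝ) • (b i - b j))

lemma coord_halve [DecidableEq ι] (i j k : ι) (x : E) :
    b.coord k (halve b i j x) = b.coord k x
      + b.coord j x * (1 / 2) * ((if k = i then 1 else 0) - (if k = j then 1 else 0)) := by
  have h1 : (b.coord k).linear (b i - b j)
      = (if k = i then (1 : ℝ) else 0) - (if k = j then 1 else 0) := by
    have := (b.coord k).linearMap_vsub (b i) (b j)
    simpa only [vsub_eq_sub, b.coord_apply] using this
  have h2 := (b.coord k).map_vadd x (b.coord j x • ((1 / 2 : ℝ) • (b i - b j)))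
  rw [vadd_eq_add, vadd_eq_add, map_smul, map_smul, h1, smul_eq_mul, smul_eq_mul] at h2
  rw [halve, add_comm x, h2]
  ring

lemma coord_halve_left {i j : ι} (hij : i ≠ j) (x : E) :
    b.coord i (halve b i j x) = b.coord i x + b.coord j x / 2 := by
  classical
  rw [coord_halve, if_pos rfl, if_neg hij]; ring

lemma coord_halve_right {i j : ι} (hij : i ≠ j) (x : E) :
    b.coord j (halve b i j x) = b.coord j x / 2 := by
  classical
  rw [coord_halve, if_pos rfl, if_neg hij.symm]; ring

lemma coord_halve_other {i j k : ι} (hki : k ≠ i) (hkj : k ≠ j) (x : E) :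
    b.coord k (halve b i j x) = b.coord k x := by
  classical
  rw [coord_halve, if_neg hki, if_neg hkj]; ring

lemma halve_injective {i j : ι} (hij : i ≠ j) : Function.Injective (halve b i j) := by
  intro x y h
  have hj : b.coord j x = b.coord j y := by
    have := congrArg (b.coord j) h
    rw [coord_halve_right b hij, coord_halve_right b hij] at this
    linarith
  unfold halve at h
  rw [hj] at h
  exact add_right_cancel h

lemma image_halve {i j : ι} (hij : i ≠ j) :
    halve b i j '' {x | ∀ k, 0 ≤ b.coord k x}
      = {x | ∀ k, 0 ≤ b.coord k x} ∩ {x | b.coord j x ≤ b.coord i x} := by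
  classical
  ext x
  constructor
  · rintro ⟨y, hy, rfl⟩
    refine ⟨fun k => ?_, ?_⟩
    · by_cases hki : k = i
      · subst hki; rw [coord_halve_left b hij]; linarith [hy k, hy j]
      · by_cases hkj : k = j
        · subst hkj; rw [coord_halve_right b hij]; linarith [hy k]
        · rw [coord_halve_other b hki hkj]; exact hy k
    · rw [mem_ofPred_eq, coord_halve_left b hij, coord_halve_right b hij]
      linarith [hy i]
  · rintro ⟨hx, hx'⟩
    rw [mem_ofPred_eq] at hx'
    -- The inverse of `halve`: coordinate j is doubled and coordinate i becomes x_i - x_j,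
    -- nonnegative exactly on the half x_j ≤ x_i.
    set y : E := x + (2 * b.coord j x) • ((1 / 2 : ℝ) • (b j - b i)) with hydef
    have hy : ∀ k, b.coord k y = b.coord k x
        + 2 * b.coord j x * (1 / 2) * ((if k = j then 1 else 0) - (if k = i then 1 else 0)) := by
      intro k
      have h1 : (b.coord k).linear (b j - b i)
          = (if k = j then (1 : ℝ) else 0) - (if k = i then 1 else 0) := by
        have := (b.coord k).linearMap_vsub (b j) (b i)
        simpa only [vsub_eq_sub, b.coord_apply] using this
      have h2 := (b.coord k).map_vadd x ((2 * b.coord j x) • ((1 / 2 : ℝ) • (b j - b i)))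
      rw [vadd_eq_add, vadd_eq_add, map_smul, map_smul, h1, smul_eq_mul, smul_eq_mul] at h2
      rw [hydef, add_comm x, h2]
      ring
    refine ⟨y, fun k => ?_, ?_⟩
    · rw [hy]
      by_cases hki : k = i
      · subst hki; rw [if_pos rfl, if_neg hij]; linarith
      · by_cases hkj : k = j
        · subst hkj; rw [if_pos rfl, if_neg hki]; linarith [hx k]
        · rw [if_neg hki, if_neg hkj]; linarith [hx k]
    · apply b.ext_elem
      intro k
      rw [coord_halve, hy, hy, if_pos rfl, if_neg hij.symm]
      ring

variable [FiniteDimensional ℝ E] [MeasurableSpace E] [BorelSpace E]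
  (μ : Measure E) [μ.IsAddHaarMeasure]

lemma continuous_coord (i : ι) : Continuous (b.coord i) :=
  (b.coord i).continuous_of_finiteDimensional

lemma isCompact_nonneg_coord : IsCompact {x | ∀ k, 0 ≤ b.coord k x} := by
  have h : convexHull ℝ (range b) = {x | ∀ k, 0 ≤ b.coord k x} := b.convexHull_eq_nonneg_coord
  rw [← h]
  exact (finite_range b).isCompact_convexHull ℝ

lemma hasFDerivAt_halve (i j : ι) (x : E) :
    HasFDerivAt (halve b i j)
      (LinearMap.toContinuousLinearMap
        (LinearMap.transvection (b.coord j).linear ((1 / 2 : ℝ) • (b i - b j)))) x := by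
  have h1 : HasFDerivAt (b.coord j) (LinearMap.toContinuousLinearMap (b.coord j).linear) x := by
    have h := (LinearMap.toContinuousLinearMap (b.coord j).linear).hasFDerivAt (x := x)
    have h2 := h.add_const (b.coord j 0)
    refine h2.congr_of_eventuallyEq (Filter.Eventually.of_forall fun y => ?_)
    have := (b.coord j).map_vadd 0 y
    simpa using this
  refine ((hasFDerivAt_id x).add (h1.smul_const ((1 / 2 : ℝ) • (b i - b j)))).congr_fderiv ?_
  ext y
  simp [LinearMap.transvection.apply]

/-- The linear part of `halve` is a transvection x ↦ x + f(x)v with f(v) = -1/2, so its determinant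
is 1 + f(v) = 1/2. -/
lemma setIntegral_image_halve {i j : ι} (hij : i ≠ j) (F : E → ℝ) :
    ∫ x in halve b i j '' {x | ∀ k, 0 ≤ b.coord k x}, F x ∂μ
      = 1 / 2 * ∫ x in {x | ∀ k, 0 ≤ b.coord k x}, F (halve b i j x) ∂μ := by
  classical
  rw [integral_image_eq_integral_abs_det_fderiv_smul μ (isCompact_nonneg_coord b).measurableSet
    (fun x _ => (hasFDerivAt_halve b i j x).hasFDerivWithinAt) (halve_injective b hij).injOn,
    ← integral_const_mul]
  have h1 : (b.coord j).linear (b i - b j) = -1 := by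
    have := (b.coord j).linearMap_vsub (b i) (b j)
    rw [vsub_eq_sub, vsub_eq_sub, b.coord_apply, b.coord_apply, if_pos rfl,
      if_neg hij.symm] at this
    rw [this]; norm_num
  have h2 : (LinearMap.toContinuousLinearMap
        (LinearMap.transvection (b.coord j).linear ((1 / 2 : ℝ) • (b i - b j)))).det = 1 / 2 := by
    rw [LinearMap.det_toContinuousLinearMap, LinearMap.transvection.det, map_smul, h1, smul_eq_mul]
    norm_num
  simp only [h2, smul_eq_mul]
  norm_num

lemma measure_coord_eq {i j : ι} (hij : i ≠ j) :
    μ {x | b.coord i x = b.coord j x} = 0 := by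
  classical
  set s : AffineSubspace ℝ E := (AffineSubspace.mk' (0 : ℝ) ⊥).comap (b.coord i - b.coord j)
  have hs : (s : Set E) = {x | b.coord i x = b.coord j x} := by
    ext x
    simp [s, AffineSubspace.mem_mk', sub_eq_zero]
  rw [← hs]
  refine Measure.addHaar_affineSubspace μ s fun h => ?_
  have h1 : b i ∈ (s : Set E) := by rw [h]; trivial
  rw [hs] at h1
  simp [b.coord_apply, hij.symm] at h1

/-- The hyperplane x_i = x_j bisects the simplex into two affine images of itself. This
self-similarity replaces explicit integration: applied to polynomials in the coordinates it gives
linear equations between moments. -/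
lemma setIntegral_halve_add {i j : ι} (hij : i ≠ j) {F : E → ℝ} (hF : Continuous F) :
    ∫ x in {x | ∀ k, 0 ≤ b.coord k x}, F x ∂μ
      = 1 / 2 * ∫ x in {x | ∀ k, 0 ≤ b.coord k x}, F (halve b i j x) ∂μ
        + 1 / 2 * ∫ x in {x | ∀ k, 0 ≤ b.coord k x}, F (halve b j i x) ∂μ := by
  rw [← setIntegral_image_halve b μ hij, ← setIntegral_image_halve b μ hij.symm,
    image_halve b hij, image_halve b hij.symm]
  set S := {x | ∀ k, 0 ≤ b.coord k x}
  have hS : IsCompact S := isCompact_nonneg_coord b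
  have hI : IntegrableOn F S μ := hF.continuousOn.integrableOn_compact hS
  have hm : MeasurableSet (S ∩ {x | b.coord i x ≤ b.coord j x}) :=
    hS.measurableSet.inter
      (isClosed_le (continuous_coord b i) (continuous_coord b j)).measurableSet
  rw [← setIntegral_union₀ _ hm.nullMeasurableSet (hI.mono_set inter_subset_left)
    (hI.mono_set inter_subset_left), ← inter_union_distrib_left]
  · congr 2
    ext x
    simp [le_total]
  · refine measure_mono_null ?_ (measure_coord_eq b μ hij)
    rintro x ⟨hx, hx'⟩
    exact le_antisymm hx'.2 hx.2

lemma integrableOn_simplex {F : E → ℝ} (hF : Continuous F) :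
    IntegrableOn F {x | ∀ k, 0 ≤ b.coord k x} μ :=
  hF.continuousOn.integrableOn_compact (isCompact_nonneg_coord b)

/-- With a_i = ∫x_i, bisection reads a_i = ½(a_i + a_j/2) + a_i/4, which forces a_i = a_j. -/
lemma setIntegral_coord_eq (i j : ι) :
    ∫ x in {x | ∀ k, 0 ≤ b.coord k x}, b.coord i x ∂μ
      = ∫ x in {x | ∀ k, 0 ≤ b.coord k x}, b.coord j x ∂μ := by
  rcases eq_or_ne i j with rfl | hij
  · rfl
  have h := setIntegral_halve_add b μ hij (continuous_coord b i)
  simp only [coord_halve_left b hij, coord_halve_right b hij.symm] at h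
  have hi := integrableOn_simplex b μ (continuous_coord b i)
  have hj := integrableOn_simplex b μ (continuous_coord b j)
  rw [integral_add hi (hj.div_const 2), integral_div, integral_div] at h
  linarith

/-- Bisection applied to x_i² and to x_j² gives two linear equations in ∫x_i², ∫x_j² and ∫x_i x_j;
eliminating ∫x_j² leaves the claim. -/
lemma setIntegral_coord_sq {i j : ι} (hij : i ≠ j) :
    ∫ x in {x | ∀ k, 0 ≤ b.coord k x}, b.coord i x ^ 2 ∂μ
      = 2 * ∫ x in {x | ∀ k, 0 ≤ b.coord k x}, b.coord i x * b.coord j x ∂μ := by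
  have ci := continuous_coord b i
  have cj := continuous_coord b j
  have hii : IntegrableOn (fun x => b.coord i x ^ 2) {x | ∀ k, 0 ≤ b.coord k x} μ :=
    integrableOn_simplex b μ (ci.pow 2)
  have hjj : IntegrableOn (fun x => b.coord j x ^ 2) {x | ∀ k, 0 ≤ b.coord k x} μ :=
    integrableOn_simplex b μ (cj.pow 2)
  have hijI : IntegrableOn (fun x => b.coord i x * b.coord j x) {x | ∀ k, 0 ≤ b.coord k x} μ :=
    integrableOn_simplex b μ (ci.mul cj)
  have h1 := setIntegral_halve_add b μ hij (ci.pow 2)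
  have h2 := setIntegral_halve_add b μ hij (cj.pow 2)
  have e1 : ∀ x, (b.coord i x + b.coord j x / 2) ^ 2
      = b.coord i x ^ 2 + b.coord i x * b.coord j x + b.coord j x ^ 2 / 4 := fun x => by ring
  have e2 : ∀ x, (b.coord j x + b.coord i x / 2) ^ 2
      = b.coord j x ^ 2 + b.coord i x * b.coord j x + b.coord i x ^ 2 / 4 := fun x => by ring
  have e3 : ∀ (k : ι) x, (b.coord k x / 2) ^ 2 = b.coord k x ^ 2 / 4 := fun k x => by ring
  simp only [Pi.pow_apply, coord_halve_left b hij, coord_halve_right b hij.symm,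
    coord_halve_left b hij.symm, coord_halve_right b hij, e1, e2, e3] at h1 h2
  rw [integral_add (by exact hii.add hijI) (hjj.div_const 4), integral_add hii hijI, integral_div,
    integral_div] at h1
  rw [integral_add (by exact hjj.add hijI) (hii.div_const 4), integral_add hjj hijI, integral_div,
    integral_div] at h2
  linarith

/-- Since the coordinates sum to 1, ∫x_i = ∑_k ∫x_i x_k; by `setIntegral_coord_sq` all these terms
are multiples of ∫x_i². -/
lemma setIntegral_coord_mul [DecidableEq ι] (i j : ι) :
    (Fintype.card ι + 1) * ∫ x in {x | ∀ k, 0 ≤ b.coord k x}, b.coord i x * b.coord j x ∂μ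
      = (if i = j then 2 else 1) * ∫ x in {x | ∀ k, 0 ≤ b.coord k x}, b.coord i x ∂μ := by
  set A := ∫ x in {x | ∀ k, 0 ≤ b.coord k x}, b.coord i x ^ 2 ∂μ with hA
  set c := ∫ x in {x | ∀ k, 0 ≤ b.coord k x}, b.coord i x ∂μ with hc
  have hB : ∀ k, ∫ x in {x | ∀ k, 0 ≤ b.coord k x}, b.coord i x * b.coord k x ∂μ
      = if i = k then A else A / 2 := by
    intro k
    split_ifs with h
    · subst h; simp only [hA, sq]
    · rw [hA, setIntegral_coord_sq b μ h]; ring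
  have hsum : c = ∑ k, if i = k then A else A / 2 := by
    simp only [← hB]
    rw [← integral_finsetSum (f := fun k x => b.coord i x * b.coord k x) _ fun k _ =>
      integrableOn_simplex b μ ((continuous_coord b i).mul (continuous_coord b k))]
    simp only [← Finset.mul_sum, b.sum_coord_apply_eq_one, mul_one, hc]
  have hsum' : c = (Fintype.card ι + 1) * (A / 2) := by
    rw [hsum, Finset.sum_congr rfl (fun k _ => show (if i = k then A else A / 2)
      = A / 2 + if i = k then A / 2 else 0 by split_ifs <;> ring), Finset.sum_add_distrib]
    simp
    ring
  rw [hB]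
  split_ifs <;> rw [hsum'] <;> ring

lemma affineMap_eq_sum_coord (f : E →ᵃ[ℝ] ℝ) (x : E) : f x = ∑ i, f (b i) * b.coord i x := by
  have hw : ∑ i, b.coord i x = 1 := b.sum_coord_apply_eq_one x
  have h := Finset.univ.map_affineCombination b (fun i => b.coord i x) hw f
  rw [b.affineCombination_coord_eq_self, Finset.affineCombination_eq_linear_combination _ _ _ hw]
    at h
  rw [h]
  simp [mul_comm]

/-- Comparison of the consistent and the lumped mass on a simplex. -/
lemma setIntegral_le_setIntegral_sq (f g : E →ᵃ[ℝ] ℝ) (hfg : ∀ i, g (b i) = f (b i) ^ 2) :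
    ∫ x in {x | ∀ k, 0 ≤ b.coord k x}, g x ∂μ
      ≤ (Fintype.card ι + 1) * ∫ x in {x | ∀ k, 0 ≤ b.coord k x}, f x ^ 2 ∂μ := by
  classical
  obtain ⟨i₀⟩ := b.nonempty
  set c := ∫ x in {x | ∀ k, 0 ≤ b.coord k x}, b.coord i₀ x ∂μ with hc
  have hc0 : 0 ≤ c := setIntegral_nonneg (isCompact_nonneg_coord b).measurableSet fun x hx => hx i₀
  have hcoord (i : ι) : ∫ x in {x | ∀ k, 0 ≤ b.coord k x}, b.coord i x ∂μ = c :=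
    setIntegral_coord_eq b μ i i₀
  have hg : ∫ x in {x | ∀ k, 0 ≤ b.coord k x}, g x ∂μ = c * ∑ i, f (b i) ^ 2 := by
    rw [show (fun x => g x) = fun x => ∑ i, g (b i) * b.coord i x from
      funext (affineMap_eq_sum_coord b g)]
    rw [integral_finsetSum (f := fun i x => g (b i) * b.coord i x) _ fun i _ =>
      integrableOn_simplex b μ (continuous_const.mul (continuous_coord b i))]
    simp only [integral_const_mul, hcoord, hfg, ← Finset.sum_mul, mul_comm c]
  -- The local mass matrix is a multiple of identity plus all-ones; dropping the nonnegative
  -- all-ones part (∑ f(b_i))² gives the inequality.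
  have hf : (Fintype.card ι + 1) * ∫ x in {x | ∀ k, 0 ≤ b.coord k x}, f x ^ 2 ∂μ
      = c * (∑ i, f (b i) ^ 2 + (∑ i, f (b i)) ^ 2) := by
    have e : ∀ x, f x ^ 2 = ∑ i, ∑ j, f (b i) * f (b j) * (b.coord i x * b.coord j x) := by
      intro x
      rw [affineMap_eq_sum_coord b f, sq, Finset.sum_mul_sum]
      exact Finset.sum_congr rfl fun i _ => Finset.sum_congr rfl fun j _ => by ring
    have hint : ∀ i j, IntegrableOn (fun x => f (b i) * f (b j) * (b.coord i x * b.coord j x))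
        {x | ∀ k, 0 ≤ b.coord k x} μ := fun i j => integrableOn_simplex b μ
      (continuous_const.mul ((continuous_coord b i).mul (continuous_coord b j)))
    rw [show (fun x => f x ^ 2) = _ from funext e]
    rw [integral_finsetSum _ fun i _ => integrable_finsetSum _ fun j _ => hint i j,
      Finset.mul_sum, mul_add, Finset.mul_sum, sq (∑ i, f (b i)), Finset.sum_mul_sum,
      Finset.mul_sum, ← Finset.sum_add_distrib]
    refine Finset.sum_congr rfl fun i _ => ?_
    rw [integral_finsetSum _ fun j _ => hint i j, Finset.mul_sum]
    simp only [integral_const_mul]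
    have : ∀ j, (Fintype.card ι + 1) * (f (b i) * f (b j) *
        ∫ x in {x | ∀ k, 0 ≤ b.coord k x}, b.coord i x * b.coord j x ∂μ)
        = c * (f (b i) * f (b j)) + if i = j then c * (f (b i) * f (b j)) else 0 := by
      intro j
      rw [mul_left_comm, setIntegral_coord_mul, hcoord]
      split_ifs <;> ring
    simp only [this, Finset.sum_add_distrib, Finset.sum_ite_eq, Finset.mem_univ, if_true,
      ← Finset.mul_sum]
    ring
  rw [hg, hf]
  nlinarith [sq_nonneg (∑ i, f (b i))]

/-- Jensen's inequality for the square, with the barycentric coordinates as weights. -/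
lemma sq_le_of_mem_simplex (f g : E →ᵃ[ℝ] ℝ) (hfg : ∀ i, g (b i) = f (b i) ^ 2) {x : E}
    (hx : ∀ k, 0 ≤ b.coord k x) : f x ^ 2 ≤ g x := by
  rw [affineMap_eq_sum_coord b f, affineMap_eq_sum_coord b g]
  have := (even_two.convexOn_pow (𝕜 := ℝ)).map_sum_le (t := Finset.univ)
    (w := fun i => b.coord i x) (p := fun i => f (b i)) (fun i _ => hx i)
    (b.sum_coord_apply_eq_one x) (fun _ _ => mem_univ _)
  simpa [hfg, mul_comm] using this

end Simplex

/-! ### Comparison of the consistent and lumped mass matrices on the mesh -/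

section Mesh

variable {n N : ℕ} {Ω : Set (Space n)} {T : Geometry.SimplicialComplex ℝ (Space n)}

/-- The `n`-dimensional cells of a triangulation. -/
abbrev Cell (T : Geometry.SimplicialComplex ℝ (Space n)) : Type :=
  {t : Finset (Space n) // t ∈ T.faces ∧ t.card = n + 1}

/-- The vertices of a cell form an affine basis. -/
noncomputable def Cell.basis (t : Cell T) : AffineBasis t.1 ℝ (Space n) :=
  ⟨(↑), T.indep t.2.1, by
    rw [(T.indep t.2.1).affineSpan_eq_top_iff_card_eq_finrank_add_one]
    simp [t.2.2]⟩

lemma Cell.basis_apply (t : Cell T) (v : t.1) : t.basis v = v := rfl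

lemma Cell.convexHull_eq (t : Cell T) :
    convexHull ℝ (t.1 : Set (Space n)) = {x | ∀ k, 0 ≤ t.basis.coord k x} := by
  have h : convexHull ℝ (range t.basis) = {x | ∀ k, 0 ≤ t.basis.coord k x} :=
    t.basis.convexHull_eq_nonneg_coord
  rw [← h]
  congr 1
  exact Subtype.range_coe.symm

lemma Cell.isCompact (t : Cell T) : IsCompact (convexHull ℝ (t.1 : Set (Space n))) :=
  t.1.finite_toSet.isCompact_convexHull ℝ

lemma IsTriangulation.finite_cell (hT : IsTriangulation Ω T) : Finite (Cell T) :=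
  (hT.finite.subset fun _ ht => ht.1 : {t : Finset (Space n) | t ∈ T.faces ∧ t.card = n + 1}.Finite)

lemma IsTriangulation.space_eq (hT : IsTriangulation Ω T) :
    T.space = ⋃ t : Cell T, convexHull ℝ (t.1 : Set (Space n)) := by
  ext x
  rw [T.mem_space_iff, mem_iUnion]
  constructor
  · rintro ⟨s, hs, hx⟩
    obtain ⟨t, ht, hst, hc⟩ := hT.pure s hs
    exact ⟨⟨t, ht, hc⟩, convexHull_mono (Finset.coe_subset.2 hst) hx⟩
  · rintro ⟨t, hx⟩
    exact ⟨t.1, t.2.1, hx⟩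

/-- Two cells meet in the hull of their common vertices. If these spanned the space there would be n
+ 1 of them, and the cells would coincide; otherwise the intersection lies in a proper affine
subspace. -/
lemma aedisjoint_cell :
    Pairwise (Function.onFun (AEDisjoint volume)
      fun t : Cell T => convexHull ℝ (t.1 : Set (Space n))) := by
  classical
  intro s t hst
  change volume (convexHull ℝ (s.1 : Set (Space n)) ∩ convexHull ℝ (t.1 : Set (Space n))) = 0
  rw [T.convexHull_inter_convexHull s.2.1 t.2.1, ← Finset.coe_inter]
  refine measure_mono_null (convexHull_subset_affineSpan _)
    (Measure.addHaar_affineSubspace volume _ fun h => ?_)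
  have hind : AffineIndependent ℝ ((↑) : (s.1 ∩ t.1 : Finset (Space n)) → Space n) :=
    (T.indep s.2.1).mono (by simp)
  have hrange : range ((↑) : (s.1 ∩ t.1 : Finset (Space n)) → Space n)
      = ((s.1 ∩ t.1 : Finset (Space n)) : Set (Space n)) := Subtype.range_coe
  rw [← hrange, hind.affineSpan_eq_top_iff_card_eq_finrank_add_one] at h
  rw [Fintype.card_coe, finrank_euclideanSpace, Fintype.card_fin] at h
  have h1 : s.1 ∩ t.1 = s.1 :=
    Finset.eq_of_subset_of_card_le Finset.inter_subset_left (by rw [h, s.2.2])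
  have h2 : s.1 ∩ t.1 = t.1 :=
    Finset.eq_of_subset_of_card_le Finset.inter_subset_right (by rw [h, t.2.2])
  exact hst (Subtype.ext (h1.symm.trans h2))

lemma meshDomain_subset_space : meshDomain T ⊆ T.space := interior_subset

lemma IsTriangulation.isCompact_space (hT : IsTriangulation Ω T) : IsCompact T.space := by
  have := hT.finite_cell
  rw [hT.space_eq]
  exact isCompact_iUnion fun t => t.isCompact

/-- As F vanishes off Ω_h, the integral may be taken over the whole union of cells, with no need to
know that the boundary is null. -/
lemma IsTriangulation.setIntegral_meshDomain (hT : IsTriangulation Ω T) [Fintype (Cell T)]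
    {F : Space n → ℝ} (hF : Continuous F) (hF0 : ∀ x, x ∉ meshDomain T → F x = 0) :
    ∫ x in meshDomain T, F x = ∑ t : Cell T, ∫ x in {x | ∀ k, 0 ≤ t.basis.coord k x}, F x := by
  have h1 : ∫ x in meshDomain T, F x = ∫ x in T.space, F x :=
    (setIntegral_eq_of_subset_of_forall_sdiff_eq_zero hT.isCompact_space.measurableSet
      meshDomain_subset_space fun x hx => hF0 x hx.2).symm
  have h2 := hasSum_integral_iUnion_ae (μ := volume) (f := F)
    (fun t : Cell T => t.isCompact.measurableSet.nullMeasurableSet) aedisjoint_cell (by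
      rw [← hT.space_eq]
      exact hF.continuousOn.integrableOn_compact hT.isCompact_space)
  rw [h1, hT.space_eq]
  refine (h2.unique (hasSum_fintype _)).trans ?_
  simp only [Cell.convexHull_eq]

lemma Cell.vertex_mem (t : Cell T) (v : t.1) : (v : Space n) ∈ T.vertices :=
  T.down_closed t.2.1 (Finset.singleton_subset_iff.2 v.2) (Finset.singleton_nonempty _)

lemma sq_le_of_mem_feSpace (hT : IsTriangulation Ω T) {y g : Space n → ℝ} (hy : y ∈ feSpace T)
    (hg : g ∈ feSpace T) (hyg : ∀ v ∈ T.vertices, g v = y v ^ 2) (x : Space n) :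
    y x ^ 2 ≤ g x := by
  by_cases hx : x ∈ meshDomain T
  · have hx' := meshDomain_subset_space hx
    rw [hT.space_eq, mem_iUnion] at hx'
    obtain ⟨t, hxt⟩ := hx'
    obtain ⟨f, hf⟩ := hy.2.1 t.1 t.2.1
    obtain ⟨e, he⟩ := hg.2.1 t.1 t.2.1
    have hv (v : t.1) : (v : Space n) ∈ convexHull ℝ (t.1 : Set (Space n)) :=
      subset_convexHull ℝ _ v.2
    rw [hf hxt, he hxt]
    rw [t.convexHull_eq] at hxt
    refine sq_le_of_mem_simplex t.basis f e (fun v => ?_) hxt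
    rw [t.basis_apply, ← hf (hv v), ← he (hv v)]
    exact hyg _ (t.vertex_mem v)
  · rw [hy.2.2 x hx, hg.2.2 x hx]; norm_num

lemma setIntegral_le_of_mem_feSpace (hT : IsTriangulation Ω T) {y g : Space n → ℝ}
    (hy : y ∈ feSpace T) (hg : g ∈ feSpace T) (hyg : ∀ v ∈ T.vertices, g v = y v ^ 2) :
    ∫ x in meshDomain T, g x ≤ (n + 2) * ∫ x in meshDomain T, y x ^ 2 := by
  have := hT.finite_cell
  have := Fintype.ofFinite (Cell T)
  rw [hT.setIntegral_meshDomain hg.1 hg.2.2, hT.setIntegral_meshDomain (F := fun x => y x ^ 2) (hy.1.pow 2)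
    (fun x hx => by simp [hy.2.2 x hx]), Finset.mul_sum]
  refine Finset.sum_le_sum fun t _ => ?_
  obtain ⟨f, hf⟩ := hy.2.1 t.1 t.2.1
  obtain ⟨e, he⟩ := hg.2.1 t.1 t.2.1
  have hv (v : t.1) : (v : Space n) ∈ convexHull ℝ (t.1 : Set (Space n)) :=
    subset_convexHull ℝ _ v.2
  have key := setIntegral_le_setIntegral_sq t.basis volume f e (fun v => by
    rw [t.basis_apply, ← hf (hv v), ← he (hv v)]
    exact hyg _ (t.vertex_mem v))
  have hm : MeasurableSet {x | ∀ k, 0 ≤ t.basis.coord k x} := by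
    rw [← t.convexHull_eq]; exact t.isCompact.measurableSet
  rw [t.convexHull_eq] at hf he
  rw [setIntegral_congr_fun hm he, setIntegral_congr_fun hm (f := fun x => y x ^ 2) (g := fun x => f x ^ 2)
    fun x hx => by simp only [hf hx]]
  refine key.trans_eq ?_
  rw [Fintype.card_coe, t.2.2]
  push_cast
  ring

lemma sum_mem_feSpace {φ : Fin N → Space n → ℝ} (hφ : ∀ i, φ i ∈ feSpace T) (c : Fin N → ℝ) :
    (fun x => ∑ i, c i * φ i x) ∈ feSpace T := by
  refine ⟨continuous_finsetSum _ fun i _ => continuous_const.mul (hφ i).1, fun s hs => ?_,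
    fun x hx => Finset.sum_eq_zero fun i _ => by rw [(hφ i).2.2 x hx, mul_zero]⟩
  choose g hg using fun i => (hφ i).2.1 s hs
  refine ⟨∑ i, c i • g i, fun x hx => ?_⟩
  simp only [hg _ hx]
  induction (Finset.univ : Finset (Fin N)) using Finset.induction_on with
  | empty => simp
  | insert a s ha ih => simp [Finset.sum_insert ha, ih]

variable {node : Fin N → Space n} {φ : Fin N → Space n → ℝ}

lemma IsNodalBasis.vertex_cases (hφ : IsNodalBasis T node φ) {v : Space n}
    (hv : v ∈ T.vertices) : (∃ j, v = node j) ∨ v ∉ meshDomain T := by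
  by_cases h : v ∈ meshDomain T
  · have : v ∈ range node := by rw [hφ.range_eq]; exact ⟨hv, h⟩
    obtain ⟨j, rfl⟩ := this
    exact Or.inl ⟨j, rfl⟩
  · exact Or.inr h

/-- A vertex is either a node, where only one basis function is nonzero, or lies off Ω_h, where both
sides vanish. So ∑ c_i² φ_i is the nodal interpolant of the squared function. -/
lemma IsNodalBasis.sum_sq_vertex (hφ : IsNodalBasis T node φ) (c : Fin N → ℝ) {v : Space n}
    (hv : v ∈ T.vertices) : ∑ i, c i ^ 2 * φ i v = (∑ i, c i * φ i v) ^ 2 := by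
  rcases hφ.vertex_cases hv with ⟨j, rfl⟩ | h
  · simp [hφ.apply_node]
  · simp [fun i => (hφ.mem i).2.2 v h]

lemma IsNodalBasis.sq_sum_le (hT : IsTriangulation Ω T) (hφ : IsNodalBasis T node φ)
    (c : Fin N → ℝ) (x : Space n) : (∑ i, c i * φ i x) ^ 2 ≤ ∑ i, c i ^ 2 * φ i x :=
  sq_le_of_mem_feSpace hT (sum_mem_feSpace hφ.mem c) (sum_mem_feSpace hφ.mem fun i => c i ^ 2)
    (fun _ hv => hφ.sum_sq_vertex c hv) x

/-- Taking c to be a unit vector in `sq_sum_le` gives φ_i² ≤ φ_i. -/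
lemma IsNodalBasis.nonneg (hT : IsTriangulation Ω T) (hφ : IsNodalBasis T node φ)
    (i : Fin N) (x : Space n) : 0 ≤ φ i x := by
  have h := hφ.sq_sum_le hT (Pi.single i 1) x
  simp only [Pi.single_apply, ite_mul, one_mul, zero_mul, Finset.sum_ite_eq', Finset.mem_univ,
    if_true, ite_pow, one_pow, ne_eq, OfNat.ofNat_ne_zero, not_false_eq_true, zero_pow] at h
  nlinarith [sq_nonneg (φ i x)]

lemma integrableOn_meshDomain (hT : IsTriangulation Ω T) {F : Space n → ℝ} (hF : Continuous F) :
    IntegrableOn F (meshDomain T) :=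
  (hF.continuousOn.integrableOn_compact hT.isCompact_space).mono_set meshDomain_subset_space

lemma IsNodalBasis.setIntegral_pos (hT : IsTriangulation Ω T) (hφ : IsNodalBasis T node φ)
    (i : Fin N) : 0 < ∫ x in meshDomain T, φ i x := by
  rw [setIntegral_pos_iff_support_of_nonneg_ae
    (Filter.Eventually.of_forall fun x => hφ.nonneg hT i x)
    (integrableOn_meshDomain hT (hφ.mem i).1)]
  have hnode : node i ∈ T.vertices ∩ meshDomain T := hφ.range_eq ▸ mem_range_self i
  have hopen : IsOpen (Function.support (φ i) ∩ meshDomain T) :=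
    ((hφ.mem i).1.isOpen_support).inter isOpen_interior
  exact hopen.measure_pos volume ⟨node i, by simp [hφ.apply_node], hnode.2⟩

lemma sqNorm_mass (hT : IsTriangulation Ω T) (hφ : IsNodalBasis T node φ) (c : Vec N) :
    sqNorm (mass T φ) c = ∫ x in meshDomain T, (∑ i, c i * φ i x) ^ 2 := by
  have e : ∀ x, (∑ i, c i * φ i x) ^ 2 = ∑ i, ∑ j, c i * c j * (φ i x * φ j x) := by
    intro x
    rw [sq, Finset.sum_mul_sum]
    exact Finset.sum_congr rfl fun i _ => Finset.sum_congr rfl fun j _ => by ring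
  have hint : ∀ i j, IntegrableOn (fun x => c i * c j * (φ i x * φ j x)) (meshDomain T) :=
    fun i j => integrableOn_meshDomain hT
      (continuous_const.mul ((hφ.mem i).1.mul (hφ.mem j).1))
  simp only [e]
  rw [integral_finsetSum _ fun i _ => integrable_finsetSum _ fun j _ => hint i j]
  simp only [sqNorm, dotProduct, mulVec, mass, Matrix.of_apply, Finset.mul_sum]
  refine Finset.sum_congr rfl fun i _ => ?_
  rw [integral_finsetSum _ fun j _ => hint i j]
  refine Finset.sum_congr rfl fun j _ => ?_
  rw [integral_const_mul]
  ring

lemma sqNorm_lumpedMass (hT : IsTriangulation Ω T) (hφ : IsNodalBasis T node φ) (c : Vec N) :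
    sqNorm (lumpedMass T φ) c = ∫ x in meshDomain T, ∑ i, c i ^ 2 * φ i x := by
  rw [integral_finsetSum (f := fun i x => c i ^ 2 * φ i x) _ fun i _ =>
    integrableOn_meshDomain hT (continuous_const.mul (hφ.mem i).1)]
  simp only [sqNorm, dotProduct, lumpedMass, mulVec_diagonal, integral_const_mul]
  exact Finset.sum_congr rfl fun i _ => by ring

/-- The consistent mass matrix is dominated by the lumped one. -/
lemma sqNorm_mass_le_lumpedMass (hT : IsTriangulation Ω T) (hφ : IsNodalBasis T node φ)
    (c : Vec N) : sqNorm (mass T φ) c ≤ sqNorm (lumpedMass T φ) c := by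
  rw [sqNorm_mass hT hφ, sqNorm_lumpedMass hT hφ]
  exact integral_mono (integrableOn_meshDomain hT ((sum_mem_feSpace hφ.mem c).1.pow 2))
    (integrableOn_meshDomain hT (sum_mem_feSpace hφ.mem fun i => c i ^ 2).1)
    fun x => hφ.sq_sum_le hT c x

/-- The lumped mass matrix is dominated by `n + 2` times the consistent one. -/
lemma sqNorm_lumpedMass_le_mass (hT : IsTriangulation Ω T) (hφ : IsNodalBasis T node φ)
    (c : Vec N) : sqNorm (lumpedMass T φ) c ≤ (n + 2) * sqNorm (mass T φ) c := by
  rw [sqNorm_mass hT hφ, sqNorm_lumpedMass hT hφ]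
  exact setIntegral_le_of_mem_feSpace hT (sum_mem_feSpace hφ.mem c)
    (sum_mem_feSpace hφ.mem fun i => c i ^ 2) fun _ hv => hφ.sum_sq_vertex c hv

lemma mass_isSymm (T : Geometry.SimplicialComplex ℝ (Space n)) (φ : Fin N → Space n → ℝ) :
    (mass T φ).IsSymm := by
  ext i j
  simp [mass, mul_comm]

lemma stiffness_isSymm {A : Fin n → Fin n → Space n → ℝ} {c₀ : Space n → ℝ}
    (hL : IsElliptic Ω A c₀) (φ : Fin N → Space n → ℝ) : (stiffness Ω A c₀ φ).IsSymm := by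
  ext i j
  simp only [stiffness, Matrix.transpose_apply, Matrix.of_apply, bilinForm]
  have h : ∀ᵐ x ∂(volume.restrict Ω), ∀ k l, A k l x = A l k x :=
    ae_all_iff.2 fun k => ae_all_iff.2 fun l => hL.symm k l
  refine integral_congr_ae (h.mono fun x hx => ?_)
  dsimp only
  rw [Finset.sum_comm]
  congr 1
  · refine Finset.sum_congr rfl fun k _ => Finset.sum_congr rfl fun l _ => ?_
    rw [hx k l]; ring
  · ring

end Mesh

/-! ### Nesterov extrapolation in an abstract seminorm -/

section Extrapolation

lemma half_le_of_recursion {t : ℕ → ℝ} (h1 : t 1 = 1)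
    (ht : ∀ k, 1 ≤ k → t (k + 1) = (1 + √(1 + 4 * t k ^ 2)) / 2) {k : ℕ} (hk : 1 ≤ k) :
    ((k : ℝ) + 1) / 2 ≤ t k := by
  induction k, hk using Nat.le_induction with
  | base => rw [h1]; norm_num
  | succ k hk ih =>
    have h0 : 0 ≤ t k := le_trans (by positivity) ih
    have : 2 * t k ≤ √(1 + 4 * t k ^ 2) := Real.le_sqrt_of_sq_le (by nlinarith)
    rw [ht k hk]
    push_cast
    linarith

lemma sq_sub_self_of_recursion {s t : ℝ} (h : s = (1 + √(1 + 4 * t ^ 2)) / 2) :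
    s ^ 2 - s = t ^ 2 := by
  have := Real.sq_sqrt (show 0 ≤ 1 + 4 * t ^ 2 by positivity)
  rw [h]
  nlinarith

variable {E : Type*} [AddCommGroup E] [Module ℝ E] {Q F : E → ℝ} {C : Set E}
  {z zt : ℕ → E} {t : ℕ → ℝ} {zs : E}

/-- Decay of the Lyapunov function of an accelerated proximal method. -/
lemma lyapunov_le (hQs : ∀ (c : ℝ) x, Q (c • x) = c ^ 2 * Q x)
    (hF : ConvexOn ℝ C F) (hzs : zs ∈ C)
    (hzt1 : zt 1 = z 0) (ht1 : t 1 = 1)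
    (ht : ∀ k, 1 ≤ k → t (k + 1) = (1 + √(1 + 4 * t k ^ 2)) / 2)
    (hzt : ∀ k, 1 ≤ k → zt (k + 1) = z k + ((t k - 1) / t (k + 1)) • (z k - z (k - 1)))
    (hzC : ∀ k, 1 ≤ k → z k ∈ C)
    (hstep : ∀ k, 1 ≤ k → ∀ w ∈ C,
      F (z k) + 1 / 2 * Q (w - z k) ≤ F w + 1 / 2 * Q (w - zt k)) {k : ℕ} (hk : 1 ≤ k) :
    t k ^ 2 * (F (z k) - F zs) + 1 / 2 * Q (t k • z k - (t k - 1) • z (k - 1) - zs)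
      ≤ 1 / 2 * Q (z 0 - zs) := by
  have hQn : ∀ x, Q (-x) = Q x := fun x => by simpa using hQs (-1) x
  induction k, hk using Nat.le_induction with
  | base =>
    have h := hstep 1 le_rfl zs hzs
    rw [hzt1, ← hQn, neg_sub, ← hQn (zs - z 0), neg_sub] at h
    simp only [ht1, one_smul, sub_self, zero_smul, sub_zero]
    linarith
  | succ k hk ih =>
    have hs : 1 ≤ t (k + 1) := by
      have := half_le_of_recursion ht1 ht (Nat.le_succ_of_le hk)
      push_cast at this
      have hk' : (1 : ℝ) ≤ k := by exact_mod_cast hk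
      linarith
    have hsq := sq_sub_self_of_recursion (ht k hk)
    have hztk := hzt k hk
    set s := t (k + 1)
    have hs0 : s ≠ 0 := by positivity
    have hinv : 1 / s ≤ 1 := by rw [div_le_one (by positivity)]; exact hs
    -- This comparison point makes s(w - z^{k+1}) and s(w - z̃^{k+1}) the negatives of two
    -- consecutive Lyapunov vectors.
    have hw : (1 - 1 / s) • z k + (1 / s) • zs ∈ C :=
      hF.1 (hzC k hk) hzs (by linarith) (by positivity) (by ring)
    have hconv : F ((1 - 1 / s) • z k + (1 / s) • zs)
        ≤ (1 - 1 / s) * F (z k) + 1 / s * F zs :=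
      hF.2 (hzC k hk) hzs (by linarith) (by positivity) (by ring)
    have h := hstep (k + 1) (by omega) _ hw
    have e1 : s ^ 2 * Q ((1 - 1 / s) • z k + (1 / s) • zs - z (k + 1))
        = Q (s • z (k + 1) - (s - 1) • z k - zs) := by
      rw [← hQs, ← hQn (s • z (k + 1) - (s - 1) • z k - zs)]
      congr 1
      match_scalars <;> field_simp
    have e2 : s ^ 2 * Q ((1 - 1 / s) • z k + (1 / s) • zs - zt (k + 1))
        = Q (t k • z k - (t k - 1) • z (k - 1) - zs) := by
      rw [← hQs, ← hQn (t k • z k - (t k - 1) • z (k - 1) - zs), hztk]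
      congr 1
      match_scalars <;> field_simp <;> ring
    rw [Nat.add_sub_cancel, ← e1]
    rw [← e2] at ih
    -- The objective gaps telescope because s²(1 - 1/s) = s² - s = t_k².
    have h2 : s ^ 2 * ((1 - 1 / s) * F (z k) + 1 / s * F zs)
        = t k ^ 2 * (F (z k) - F zs) + s ^ 2 * F zs := by
      rw [← hsq]; field_simp; ring
    have h3 := mul_le_mul_of_nonneg_left (h.trans (add_le_add_left hconv _)) (sq_nonneg s)
    rw [mul_add, mul_add, h2] at h3
    linarith

/-- Boundedness of the iterates in the proximal seminorm. -/
lemma seminorm_iterates_le (hQ : ConvexOn ℝ univ Q) (ht : ∀ k, 1 ≤ k → 1 ≤ t k)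
    (hu : ∀ k, 1 ≤ k →
      Q (t k • z k - (t k - 1) • z (k - 1) - zs) ≤ Q (z 0 - zs)) (k : ℕ) :
    Q (z k - zs) ≤ Q (z 0 - zs) := by
  induction k with
  | zero => exact le_rfl
  | succ k ih =>
    have hs := ht (k + 1) (by omega)
    have h := hu (k + 1) (by omega)
    rw [Nat.add_sub_cancel] at h
    set s := t (k + 1)
    have hs0 : s ≠ 0 := by positivity
    have hinv : 1 / s ≤ 1 := by rw [div_le_one (by positivity)]; exact hs
    -- z^{k+1} - z* is a convex combination of z^k - z* and the Lyapunov vector, with weight 1/s on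
    -- the latter.
    have hc := hQ.2 (mem_univ (z k - zs)) (mem_univ (s • z (k + 1) - (s - 1) • z k - zs))
      (show 0 ≤ 1 - 1 / s by linarith) (show 0 ≤ 1 / s by positivity) (by ring)
    have e : (1 - 1 / s) • (z k - zs) + (1 / s) • (s • z (k + 1) - (s - 1) • z k - zs)
        = z (k + 1) - zs := by
      match_scalars <;> field_simp <;> ring
    rw [e, smul_eq_mul, smul_eq_mul] at hc
    have h1 := mul_le_mul_of_nonneg_left ih (show 0 ≤ 1 - 1 / s by linarith)
    have h2 := mul_le_mul_of_nonneg_left h (show 0 ≤ 1 / s by positivity)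
    linarith

end Extrapolation

/-! ### Matrix quadratic forms -/

section QuadraticForms

variable {N : ℕ}

/-- The bilinear form `⟨x, A y⟩`. -/
def blf (A : Matrix (Fin N) (Fin N) ℝ) (x y : Vec N) : ℝ := x ⬝ᵥ A *ᵥ y

variable (A B : Matrix (Fin N) (Fin N) ℝ) (x y z : Vec N) (c : ℝ)

lemma sqNorm_eq_blf : sqNorm A x = blf A x x := rfl

lemma blf_add_left : blf A (x + y) z = blf A x z + blf A y z := add_dotProduct _ _ _

lemma blf_sub_left : blf A (x - y) z = blf A x z - blf A y z := sub_dotProduct _ _ _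

lemma blf_smul_left : blf A (c • x) z = c * blf A x z := smul_dotProduct _ _ _

lemma blf_add_right : blf A x (y + z) = blf A x y + blf A x z := by
  rw [blf, mulVec_add, dotProduct_add]; rfl

lemma blf_sub_right : blf A x (y - z) = blf A x y - blf A x z := by
  rw [blf, mulVec_sub, dotProduct_sub]; rfl

lemma blf_smul_right : blf A x (c • z) = c * blf A x z := by
  rw [blf, mulVec_smul, dotProduct_smul]; rfl

lemma blf_add_matrix : blf (A + B) x y = blf A x y + blf B x y := by
  rw [blf, add_mulVec, dotProduct_add]; rfl

lemma blf_sub_matrix : blf (A - B) x y = blf A x y - blf B x y := by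
  rw [blf, sub_mulVec, dotProduct_sub]; rfl

lemma blf_smul_matrix : blf (c • A) x y = c * blf A x y := by
  rw [blf, smul_mulVec, dotProduct_smul]; rfl

lemma blf_mul_matrix : blf (A * B) x y = blf A x (B *ᵥ y) := by
  rw [blf, blf, mulVec_mulVec]

variable {A}

lemma blf_mulVec_left (hA : A.IsSymm) : blf B (A *ᵥ x) y = blf (A * B) x y := by
  rw [blf, blf, ← mulVec_mulVec, dotProduct_mulVec x A, ← mulVec_transpose, hA.eq]

lemma blf_comm (hA : A.IsSymm) : blf A x y = blf A y x := by
  rw [blf, blf, dotProduct_mulVec, ← mulVec_transpose, hA.eq, dotProduct_comm]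

lemma sqNorm_smul (c : ℝ) (x : Vec N) : sqNorm A (c • x) = c ^ 2 * sqNorm A x := by
  rw [sqNorm_eq_blf, sqNorm_eq_blf, blf_smul_left, blf_smul_right]; ring

lemma sqNorm_add (hA : A.IsSymm) : sqNorm A (x + y) = sqNorm A x + 2 * blf A x y + sqNorm A y := by
  simp only [sqNorm_eq_blf, blf_add_left, blf_add_right, blf_comm y x hA]; ring

lemma convexOn_sqNorm (hA : ∀ x, 0 ≤ sqNorm A x) : ConvexOn ℝ univ (sqNorm A) := by
  refine ⟨convex_univ, fun x _ y _ s t hs ht hst => ?_⟩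
  have h := mul_nonneg (mul_nonneg hs ht) (hA (x - y))
  obtain rfl : s = 1 - t := by linarith
  simp only [sqNorm_eq_blf, blf_add_left, blf_add_right, blf_smul_left, blf_smul_right,
    blf_sub_left, blf_sub_right, smul_eq_mul] at h ⊢
  linarith

lemma PosDef.isSymm (hA : A.PosDef) : A.IsSymm := by
  have := hA.isHermitian.eq
  rwa [conjTranspose_eq_transpose_of_trivial] at this

lemma PosDef.sqNorm_nonneg (hA : A.PosDef) (x : Vec N) : 0 ≤ sqNorm A x := by
  have := hA.posSemidef.dotProduct_mulVec_nonneg x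
  rwa [star_trivial] at this

lemma posDef_of_sqNorm_pos (hA : A.IsSymm) (h : ∀ x, x ≠ 0 → 0 < sqNorm A x) : A.PosDef :=
  PosDef.of_dotProduct_mulVec_pos (by rw [IsHermitian, conjTranspose_eq_transpose_of_trivial, hA.eq])
    fun x hx => by rw [star_trivial]; exact h x hx

lemma PosDef.mul_inv (hA : A.PosDef) : A * A⁻¹ = 1 :=
  Matrix.mul_nonsing_inv _ ((Matrix.isUnit_iff_isUnit_det _).1 hA.isUnit)

lemma PosDef.inv_mul (hA : A.PosDef) : A⁻¹ * A = 1 :=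
  Matrix.nonsing_inv_mul _ ((Matrix.isUnit_iff_isUnit_det _).1 hA.isUnit)

lemma sqNorm_diagonal (w x : Vec N) : sqNorm (diagonal w) x = ∑ i, w i * x i ^ 2 := by
  simp only [sqNorm, dotProduct, mulVec_diagonal]
  exact Finset.sum_congr rfl fun i _ => by ring

/-- If `W ≤ γ M` then `M ≤ γ M W⁻¹ M`. -/
lemma sqNorm_le_smul_mul_inv_mul {M W : Matrix (Fin N) (Fin N) ℝ} {γ : ℝ} (hγ : 0 < γ)
    (hM : M.IsSymm) (hW : W.PosDef) (h : ∀ x, sqNorm W x ≤ γ * sqNorm M x) (x : Vec N) :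
    sqNorm M x ≤ sqNorm (γ • (M * W⁻¹ * M)) x := by
  -- Expanding ‖x - γW⁻¹Mx‖²_W ≥ 0 gives 2γM ≤ W + γ²MW⁻¹M as forms; then W ≤ γM is inserted.
  have h1 := PosDef.sqNorm_nonneg hW (x - γ • (W⁻¹ *ᵥ (M *ᵥ x)))
  have e1 : blf W x (W⁻¹ *ᵥ (M *ᵥ x)) = blf M x x := by
    rw [← blf_mul_matrix, PosDef.mul_inv hW, blf, one_mulVec]; rfl
  have e2 : blf W (W⁻¹ *ᵥ (M *ᵥ x)) (W⁻¹ *ᵥ (M *ᵥ x)) = blf (M * W⁻¹ * M) x x := by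
    rw [blf_mulVec_left _ _ _ (PosDef.isSymm hW.inv), PosDef.inv_mul hW, blf, one_mulVec,
      blf_mul_matrix, ← blf_mulVec_left _ _ _ hM, blf]
  have h2 := h x
  simp only [sqNorm_eq_blf, blf_sub_left, blf_sub_right, blf_smul_left, blf_smul_right, e1,
    blf_comm (W⁻¹ *ᵥ (M *ᵥ x)) x (PosDef.isSymm hW), e2, blf_smul_matrix] at h1 h2 ⊢
  have h3 : 0 ≤ γ * (γ * blf (M * W⁻¹ * M) x x - blf M x x) := by linarith
  have := nonneg_of_mul_nonneg_right h3 hγ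
  linarith

/-- First-order optimality without derivatives: p is the slope of the objective along a segment from
a minimizer, s²q the quadratic remainder. -/
lemma nonneg_of_forall_mul_add_sq {p q : ℝ} (h : ∀ s : ℝ, 0 < s → s ≤ 1 → 0 ≤ s * p + s ^ 2 * q) :
    0 ≤ p := by
  by_contra! hp
  have hq : 0 < 1 + |q| := by positivity
  obtain ⟨s, hs, hs1, hs2⟩ : ∃ s : ℝ, 0 < s ∧ s ≤ 1 ∧ s * (1 + |q|) < -p := by
    refine ⟨min 1 (-p / (2 * (1 + |q|))), lt_min one_pos (by apply div_pos <;> linarith),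
      min_le_left _ _, ?_⟩
    calc _ ≤ -p / (2 * (1 + |q|)) * (1 + |q|) := by gcongr; exact min_le_right _ _
      _ = -p / 2 := by field_simp
      _ < -p := by linarith
  have h1 := h s hs hs1
  have h2 : 0 ≤ p + s * q := by
    rw [show s * p + s ^ 2 * q = s * (p + s * q) by ring] at h1
    exact nonneg_of_mul_nonneg_right h1 hs
  nlinarith [le_abs_self q]

end QuadraticForms

/-! ### Optimality conditions of the subproblems -/

section Subproblems

variable {N : ℕ} {α β a b γ : ℝ} {K M W : Matrix (Fin N) (Fin N) ℝ} {yd yr : Vec N}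

lemma suppFn_box (hab : a ≤ b) (x : Vec N) :
    suppFn (box a b) x = ((∑ i, max (a * x i) (b * x i) : ℝ) : EReal) := by
  apply le_antisymm
  · refine iSup₂_le fun s hs => EReal.coe_le_coe_iff.2 (Finset.sum_le_sum fun i _ => ?_)
    rcases le_total 0 (x i) with h | h
    · exact le_max_of_le_right (by nlinarith [hs i])
    · exact le_max_of_le_left (by nlinarith [hs i])
  · refine le_iSup₂_of_le (fun i => if 0 ≤ x i then b else a) (fun i => ?_)
      (EReal.coe_le_coe_iff.2 (Finset.sum_le_sum fun i _ => ?_))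
    · dsimp only
      split_ifs
      · exact ⟨hab, le_rfl⟩
      · exact ⟨le_rfl, hab⟩
    · dsimp only
      split_ifs with h
      · exact max_le (by nlinarith) (by linarith)
      · exact max_le (by linarith) (by nlinarith)

/-- The support function of the box, composed with `M`. -/
def suppBox (a b : ℝ) (M : Matrix (Fin N) (Fin N) ℝ) (x : Vec N) : ℝ :=
  ∑ i, max (a * (M *ᵥ x) i) (b * (M *ᵥ x) i)

lemma convexOn_suppBox (a b : ℝ) (M : Matrix (Fin N) (Fin N) ℝ) :
    ConvexOn ℝ univ (suppBox a b M) := by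
  refine ⟨convex_univ, fun x _ y _ s t hs ht _ => ?_⟩
  simp only [suppBox, smul_eq_mul, Finset.mul_sum, ← Finset.sum_add_distrib]
  refine Finset.sum_le_sum fun i _ => ?_
  rw [mulVec_add, mulVec_smul, mulVec_smul]
  simp only [Pi.add_apply, Pi.smul_apply, smul_eq_mul]
  refine max_le ?_ ?_
  · have h1 := mul_le_mul_of_nonneg_left (le_max_left (a * (M *ᵥ x) i) (b * (M *ᵥ x) i)) hs
    have h2 := mul_le_mul_of_nonneg_left (le_max_left (a * (M *ᵥ y) i) (b * (M *ᵥ y) i)) ht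
    linarith
  · have h1 := mul_le_mul_of_nonneg_left (le_max_right (a * (M *ᵥ x) i) (b * (M *ᵥ x) i)) hs
    have h2 := mul_le_mul_of_nonneg_left (le_max_right (a * (M *ᵥ y) i) (b * (M *ᵥ y) i)) ht
    linarith

lemma convex_box (l u : ℝ) : Convex ℝ (box l u : Set (Vec N)) := by
  have : (box l u : Set (Vec N)) = Icc (fun _ => l) (fun _ => u) := by
    ext x; simp [box, Pi.le_def, forall_and]
  rw [this]
  exact convex_Icc _ _

lemma pObj_stationary (hM : M.PosDef) {lam mu p : Vec N}
    (hp : IsMinOn (pObj α K M yd yr lam mu) univ p) (d : Vec N) :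
    blf M⁻¹ (K *ᵥ p - M *ᵥ yd) (K *ᵥ d) + 1 / α * blf M (p - lam - mu) d
      + (M *ᵥ yr) ⬝ᵥ d = 0 := by
  have hN := PosDef.isSymm hM.inv
  have hMs := PosDef.isSymm hM
  have key : ∀ (d : Vec N) (s : ℝ), 0 < s → s ≤ 1 →
      0 ≤ s * (blf M⁻¹ (K *ᵥ p - M *ᵥ yd) (K *ᵥ d) + 1 / α * blf M (p - lam - mu) d
        + (M *ᵥ yr) ⬝ᵥ d)
        + s ^ 2 * (1 / 2 * sqNorm M⁻¹ (K *ᵥ d) + 1 / (2 * α) * sqNorm M d) := by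
    intro d s _ _
    have h := isMinOn_iff.1 hp (p + s • d) (mem_univ _)
    have e1 : K *ᵥ (p + s • d) - M *ᵥ yd = (K *ᵥ p - M *ᵥ yd) + s • K *ᵥ d := by
      rw [mulVec_add, mulVec_smul]; abel
    have e2 : p + s • d - lam - mu = (p - lam - mu) + s • d := by abel
    rw [pObj, pObj, e1, e2, sqNorm_add _ _ hN, sqNorm_add _ _ hMs, sqNorm_smul, sqNorm_smul,
      blf_smul_right, blf_smul_right, dotProduct_add, dotProduct_smul, smul_eq_mul] at h
    have : 1 / (2 * α) = 1 / 2 * (1 / α) := by rw [one_div_mul_one_div]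
    rw [this] at h ⊢
    linarith
  have h1 := nonneg_of_forall_mul_add_sq (key d)
  have h2 := nonneg_of_forall_mul_add_sq (key (-d))
  rw [← neg_one_smul ℝ d, mulVec_smul, blf_smul_right, blf_smul_right, dotProduct_smul,
    smul_eq_mul] at h2
  linarith

/-- The matrix of the `p`-subproblem, multiplied by `α`. -/
noncomputable def pMat (α : ℝ) (K M : Matrix (Fin N) (Fin N) ℝ) : Matrix (Fin N) (Fin N) ℝ :=
  M + α • (K * M⁻¹ * K)

lemma posDef_pMat (hα : 0 < α) (hM : M.PosDef) (hK : K.IsSymm) : (pMat α K M).PosDef := by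
  have h := hM.inv.posSemidef.conjTranspose_mul_mul_same K
  rw [conjTranspose_eq_transpose_of_trivial, hK.eq] at h
  exact hM.add_posSemidef (h.smul hα.le)

/-- The normal equation of the p-subproblem, scaled by α. It exhibits p as an affine function of λ +
μ, which serves both the Gauss-Seidel identity and the boundedness of p. -/
lemma pMat_mulVec (hα : 0 < α) (hM : M.PosDef) (hK : K.IsSymm) {lam mu p : Vec N}
    (hp : IsMinOn (pObj α K M yd yr lam mu) univ p) :
    pMat α K M *ᵥ p = M *ᵥ (lam + mu) + α • (K *ᵥ yd - M *ᵥ yr) := by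
  refine dotProduct_eq _ _ fun d => ?_
  have h := pObj_stationary hM hp d
  have hMs := PosDef.isSymm hM
  have e1 : blf M⁻¹ (K *ᵥ p - M *ᵥ yd) (K *ᵥ d)
      = ((K * M⁻¹ * K) *ᵥ p) ⬝ᵥ d - (K *ᵥ yd) ⬝ᵥ d := by
    rw [blf_comm _ _ (PosDef.isSymm hM.inv), blf_mulVec_left _ _ _ hK, blf, mulVec_sub,
      mulVec_mulVec, mulVec_mulVec, mul_assoc K M⁻¹ M, PosDef.inv_mul hM, mul_one,
      dotProduct_sub, dotProduct_comm d, dotProduct_comm d]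
  have e2 : blf M (p - lam - mu) d = (M *ᵥ p) ⬝ᵥ d - (M *ᵥ (lam + mu)) ⬝ᵥ d := by
    rw [blf_comm _ _ hMs, blf, sub_sub, mulVec_sub, dotProduct_sub, dotProduct_comm d,
      dotProduct_comm d]
  rw [e1, e2] at h
  rw [pMat, add_mulVec, smul_mulVec, add_dotProduct, add_dotProduct, smul_dotProduct,
    smul_dotProduct, sub_dotProduct, smul_eq_mul, smul_eq_mul]
  have h2 : α * (1 / α) = 1 := by field_simp
  linear_combination α * h - ((M *ᵥ p) ⬝ᵥ d - (M *ᵥ (lam + mu)) ⬝ᵥ d) * h2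

/-- The proximal matrix of the `λ`-block, multiplied by `α`. -/
noncomputable def lamMat (α : ℝ) (K M W : Matrix (Fin N) (Fin N) ℝ) : Matrix (Fin N) (Fin N) ℝ :=
  M * (pMat α K M)⁻¹ * M + W - M

lemma lamObj_coe {phat lamt mt x : Vec N} (hx : x ∈ box (-β) β) :
    lamObj α β M W phat lamt mt x
      = ((1 / (2 * α) * sqNorm M (x - (phat - mt))
        + 1 / (2 * α) * sqNorm (W - M) (x - lamt) : ℝ) : EReal) := by
  rw [lamObj, indic, if_pos hx, zero_add]

lemma mem_box_of_isMinOn (hβ : 0 ≤ β) {phat lamt mt lam : Vec N}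
    (h : IsMinOn (lamObj α β M W phat lamt mt) univ lam) : lam ∈ box (-β) β := by
  by_contra hlam
  have h0 : (0 : Vec N) ∈ box (-β) β := fun i => ⟨by simpa using hβ, hβ⟩
  have h1 := isMinOn_iff.1 h 0 (mem_univ _)
  rw [lamObj_coe h0, lamObj, indic, if_neg hlam, EReal.top_add_coe, top_le_iff] at h1
  exact EReal.coe_ne_top _ h1

lemma lamObj_variational (hα : 0 < α) (hM : M.IsSymm) (hW : W.IsSymm)
    {phat lamt mt lam x : Vec N} (h : IsMinOn (lamObj α β M W phat lamt mt) univ lam)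
    (hlam : lam ∈ box (-β) β) (hx : x ∈ box (-β) β) :
    0 ≤ blf M (lam - (phat - mt)) (x - lam) + blf (W - M) (lam - lamt) (x - lam) := by
  refine nonneg_of_forall_mul_add_sq
    (q := 1 / 2 * sqNorm M (x - lam) + 1 / 2 * sqNorm (W - M) (x - lam)) fun s hs hs1 => ?_
  have hxs : lam + s • (x - lam) ∈ box (-β) β :=
    (convex_box _ _).add_smul_sub_mem hlam hx ⟨hs.le, hs1⟩
  have h1 := isMinOn_iff.1 h _ (mem_univ (lam + s • (x - lam)))
  rw [lamObj_coe hlam, lamObj_coe hxs, EReal.coe_le_coe_iff] at h1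
  rw [add_sub_right_comm, add_sub_right_comm, sqNorm_add _ _ hM, sqNorm_add _ _ (hW.sub hM),
    sqNorm_smul, sqNorm_smul, blf_smul_right, blf_smul_right, ← mul_add, ← mul_add] at h1
  have h2 := le_of_mul_le_mul_left h1 (by positivity)
  linarith

/-- The variational inequality for `λ` after the symmetric Gauss-Seidel sweep. -/
lemma sGS_variational (hα : 0 < α) (hM : M.PosDef) (hK : K.IsSymm) (hW : W.IsSymm)
    {phat lamt mt lam p x : Vec N} (hphat : IsMinOn (pObj α K M yd yr lamt mt) univ phat)
    (h : IsMinOn (lamObj α β M W phat lamt mt) univ lam)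
    (hp : IsMinOn (pObj α K M yd yr lam mt) univ p)
    (hlam : lam ∈ box (-β) β) (hx : x ∈ box (-β) β) :
    0 ≤ blf M (lam + mt - p) (x - lam) + blf (lamMat α K M W) (lam - lamt) (x - lam) := by
  have hMs := PosDef.isSymm hM
  have h1 := lamObj_variational hα hMs hW h hlam hx
  have hP := posDef_pMat hα hM hK
  have h2 : pMat α K M *ᵥ (p - phat) = M *ᵥ (lam - lamt) := by
    rw [mulVec_sub, pMat_mulVec hα hM hK hp, pMat_mulVec hα hM hK hphat,
      add_sub_add_right_eq_sub, ← mulVec_sub, add_sub_add_right_eq_sub]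
  have h3 : p - phat = (pMat α K M)⁻¹ *ᵥ (M *ᵥ (lam - lamt)) := by
    rw [← h2, mulVec_mulVec, PosDef.inv_mul hP, one_mulVec]
  have h4 : blf M (p - phat) (x - lam)
      = blf (M * (pMat α K M)⁻¹ * M) (lam - lamt) (x - lam) := by
    rw [h3, blf_mulVec_left _ _ _ (PosDef.isSymm hP.inv), blf_mulVec_left _ _ _ hMs, mul_assoc]
  -- Trading p̂ for p costs M(p - p̂) = MP⁻¹M(λ - λ̃), which is absorbed into the proximal matrix.
  have e : lam - (phat - mt) = (lam + mt - p) + (p - phat) := by abel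
  rw [e, blf_add_left, h4] at h1
  rw [lamMat, add_sub_assoc (M * _ * M), blf_add_matrix]
  linarith

lemma muObj_coe (hab : a ≤ b) (lam p mt mu : Vec N) :
    muObj α a b γ M W lam p mt mu = ((suppBox a b M mu + (1 / (2 * α) * sqNorm M (mu - (p - lam))
        + 1 / (2 * α) * sqNorm (γ • (M * W⁻¹ * M) - M) (mu - mt)) : ℝ) : EReal) := by
  rw [muObj, suppFn_box hab, ← EReal.coe_add]; rfl

lemma muObj_variational (hab : a ≤ b) (hM : M.IsSymm)
    (hV : (γ • (M * W⁻¹ * M)).IsSymm) {lam p mt mu : Vec N}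
    (h : IsMinOn (muObj α a b γ M W lam p mt) univ mu) (x : Vec N) :
    0 ≤ suppBox a b M x - suppBox a b M mu + 1 / α * (blf M (mu - (p - lam)) (x - mu)
      + blf (γ • (M * W⁻¹ * M) - M) (mu - mt) (x - mu)) := by
  refine nonneg_of_forall_mul_add_sq
    (q := 1 / (2 * α) * (sqNorm M (x - mu) + sqNorm (γ • (M * W⁻¹ * M) - M) (x - mu)))
    fun s hs hs1 => ?_
  have h1 := isMinOn_iff.1 h _ (mem_univ (mu + s • (x - mu)))
  rw [muObj_coe hab, muObj_coe hab, EReal.coe_le_coe_iff] at h1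
  have h2 : suppBox a b M (mu + s • (x - mu))
      ≤ (1 - s) * suppBox a b M mu + s * suppBox a b M x := by
    have e : mu + s • (x - mu) = (1 - s) • mu + s • x := by module
    rw [e]
    exact (convexOn_suppBox a b M).2 (mem_univ _) (mem_univ _) (by linarith) hs.le (by ring)
  rw [add_sub_right_comm, add_sub_right_comm, sqNorm_add _ _ hM, sqNorm_add _ _ (hV.sub hM),
    sqNorm_smul, sqNorm_smul, blf_smul_right, blf_smul_right] at h1
  have : 1 / (2 * α) = 1 / 2 * (1 / α) := by rw [one_div_mul_one_div]
  rw [this] at h1 ⊢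
  linarith

end Subproblems

/-! ### Three-point inequality for one sweep -/

section Convergence

variable {N : ℕ} {α β a b γ : ℝ} {K M W : Matrix (Fin N) (Fin N) ℝ} {yd yr : Vec N}

/-- Algebraic core of the three-point inequality of a two-block descent step. -/
lemma two_block_descent {H M R V : Matrix (Fin N) (Fin N) ℝ} {c g : ℝ} (hc : 0 ≤ c)
    (hM : M.IsSymm) (hR : R.IsSymm) (hV : V.IsSymm) (hH0 : ∀ x, 0 ≤ sqNorm H x)
    (hM0 : ∀ x, 0 ≤ sqNorm M x) (hR0 : ∀ x, 0 ≤ sqNorm R x)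
    (hMV : ∀ x, sqNorm M x ≤ sqNorm V x) {u v e ε η r dl dp dm : Vec N}
    (hp : blf H u v - c * blf M (e - ε) dp + r ⬝ᵥ dp = 0)
    (hl : 0 ≤ blf M (e - ε) dl + blf R η dl)
    (hm : 0 ≤ g + c * (blf M e dm + blf (V - M) ε dm)) :
    c * (1 / 2 * (sqNorm R dl + sqNorm V dm))
      ≤ blf H u v + 1 / 2 * sqNorm H v
        + c * (blf M e (dl + dm - dp) + 1 / 2 * sqNorm M (dl + dm - dp)) + r ⬝ᵥ dp + g
        + c * (1 / 2 * (sqNorm R (dl + η) + sqNorm V (dm + ε))) := by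
  have h1 := hH0 v
  have h2 := mul_nonneg hc (hM0 (dl - dp + (dm + ε)))
  have h3 := mul_nonneg hc (hR0 η)
  have h4 := mul_nonneg hc (sub_nonneg.2 (hMV ε))
  have h5 := mul_nonneg hc hl
  simp only [sqNorm_eq_blf, blf_add_left, blf_add_right, blf_sub_left, blf_sub_right,
    blf_sub_matrix, blf_comm dp dl hM, blf_comm dm dl hM, blf_comm dm dp hM, blf_comm ε dl hM,
    blf_comm ε dp hM, blf_comm ε dm hM, blf_comm η dl hR, blf_comm ε dm hV] at *
  linarith

/-- The objective function of the dual problem on its domain. -/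
noncomputable def dualReal (α a b : ℝ) (K M : Matrix (Fin N) (Fin N) ℝ) (yd yr : Vec N)
    (z : Dual N) : ℝ :=
  1 / 2 * sqNorm M⁻¹ (K *ᵥ z.2.1 - M *ᵥ yd) + 1 / (2 * α) * sqNorm M (z.1 + z.2.2 - z.2.1)
    + (M *ᵥ yr) ⬝ᵥ z.2.1 - 1 / 2 * sqNorm M yd + suppBox a b M z.2.2

lemma dualObj_coe (hab : a ≤ b) {z : Dual N} (hz : z.1 ∈ box (-β) β) :
    dualObj α β a b K M yd yr z = (dualReal α a b K M yd yr z : EReal) := by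
  rw [dualObj, indic, if_pos hz, add_zero, suppFn_box hab, ← EReal.coe_add]; rfl

lemma mem_box_of_isMinOn_dualObj (hab : a ≤ b) (hβ : 0 ≤ β) {z : Dual N}
    (h : IsMinOn (dualObj α β a b K M yd yr) univ z) : z.1 ∈ box (-β) β := by
  by_contra hz
  have h0 : (0 : Dual N).1 ∈ box (-β) β := fun i => ⟨by simpa using hβ, hβ⟩
  have h1 := isMinOn_iff.1 h 0 (mem_univ _)
  rw [dualObj_coe hab h0, dualObj, indic, if_neg hz, EReal.coe_add_top, suppFn_box hab,
    EReal.top_add_coe, top_le_iff] at h1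
  exact EReal.coe_ne_top _ h1

lemma convexOn_dualReal (hα : 0 < α) (hM : M.PosDef) :
    ConvexOn ℝ {z : Dual N | z.1 ∈ box (-β) β} (dualReal α a b K M yd yr) := by
  refine ⟨(convex_box (-β) β).linear_preimage (LinearMap.fst ℝ _ _),
    fun x _ y _ s t hs ht hst => ?_⟩
  have h1 := (convexOn_sqNorm (PosDef.sqNorm_nonneg hM.inv)).2
    (mem_univ (K *ᵥ x.2.1 - M *ᵥ yd)) (mem_univ (K *ᵥ y.2.1 - M *ᵥ yd)) hs ht hst
  have h2 := (convexOn_sqNorm (PosDef.sqNorm_nonneg hM)).2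
    (mem_univ (x.1 + x.2.2 - x.2.1)) (mem_univ (y.1 + y.2.2 - y.2.1)) hs ht hst
  have h3 := (convexOn_suppBox a b M).2 (mem_univ x.2.2) (mem_univ y.2.2) hs ht hst
  obtain rfl : s = 1 - t := by linarith
  have e1 : K *ᵥ ((1 - t) • x + t • y).2.1 - M *ᵥ yd
      = (1 - t) • (K *ᵥ x.2.1 - M *ᵥ yd) + t • (K *ᵥ y.2.1 - M *ᵥ yd) := by
    simp only [Prod.snd_add, Prod.fst_add, Prod.smul_snd, Prod.smul_fst, mulVec_add, mulVec_smul]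
    module
  have e2 : ((1 - t) • x + t • y).1 + ((1 - t) • x + t • y).2.2 - ((1 - t) • x + t • y).2.1
      = (1 - t) • (x.1 + x.2.2 - x.2.1) + t • (y.1 + y.2.2 - y.2.1) := by
    simp only [Prod.snd_add, Prod.fst_add, Prod.smul_snd, Prod.smul_fst]
    module
  have e3 : (M *ᵥ yr) ⬝ᵥ ((1 - t) • x + t • y).2.1
      = (1 - t) * (M *ᵥ yr) ⬝ᵥ x.2.1 + t * (M *ᵥ yr) ⬝ᵥ y.2.1 := by
    simp only [Prod.snd_add, Prod.fst_add, Prod.smul_snd, Prod.smul_fst, dotProduct_add,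
      dotProduct_smul, smul_eq_mul]
  have e4 : ((1 - t) • x + t • y).2.2 = (1 - t) • x.2.2 + t • y.2.2 := rfl
  have h4 := mul_le_mul_of_nonneg_left h2 (show 0 ≤ 1 / (2 * α) by positivity)
  rw [dualReal, e1, e2, e3, e4]
  simp only [smul_eq_mul, dualReal] at h1 h3 h4 ⊢
  linarith

/-- The squared proximal seminorm `‖z‖²` associated with the block matrix `S_h`. -/
noncomputable def proxSq (α γ : ℝ) (K M W : Matrix (Fin N) (Fin N) ℝ) (z : Dual N) : ℝ :=
  1 / α * (sqNorm (lamMat α K M W) z.1 + sqNorm (γ • (M * W⁻¹ * M)) z.2.2)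

lemma tauh_eq (z₀ zs : Dual N) :
    tauh α γ K M W z₀ zs = 1 / 2 * proxSq α γ K M W (z₀ - zs) := by
  rw [tauh, sqNorm, shMatrix, stack, smul_mulVec, dotProduct_smul, fromBlocks_mulVec]
  simp only [Sum.elim_comp_inl, Sum.elim_comp_inr, fromBlocks_mulVec, zero_mulVec, add_zero,
    zero_add, sumElim_dotProduct_sumElim, dotProduct_zero, smul_eq_mul]
  rfl

lemma proxSq_smul (c : ℝ) (z : Dual N) :
    proxSq α γ K M W (c • z) = c ^ 2 * proxSq α γ K M W z := by
  simp only [proxSq, Prod.smul_fst, Prod.smul_snd, sqNorm_smul]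
  ring

lemma isSymm_mul_mul {A B : Matrix (Fin N) (Fin N) ℝ} (hA : A.IsSymm) (hB : B.IsSymm) :
    (A * B * A).IsSymm := by
  rw [Matrix.IsSymm, transpose_mul, transpose_mul, hA.eq, hB.eq, mul_assoc]

lemma sqNorm_lamMat_nonneg (hα : 0 < α) (hM : M.PosDef) (hK : K.IsSymm)
    (hMW : ∀ x, sqNorm M x ≤ sqNorm W x) (x : Vec N) : 0 ≤ sqNorm (lamMat α K M W) x := by
  have h := PosDef.sqNorm_nonneg (posDef_pMat hα hM hK).inv (M *ᵥ x)
  have h2 := hMW x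
  have hMs := PosDef.isSymm hM
  rw [sqNorm_eq_blf, blf_mulVec_left _ _ _ hMs, ← blf_mul_matrix] at h
  rw [sqNorm_eq_blf, sqNorm_eq_blf] at h2
  rw [sqNorm_eq_blf, lamMat, blf_sub_matrix, blf_add_matrix]
  linarith

lemma convexOn_proxSq (hα : 0 < α) (hL : ∀ x, 0 ≤ sqNorm (lamMat α K M W) x)
    (hV : ∀ x, 0 ≤ sqNorm (γ • (M * W⁻¹ * M)) x) : ConvexOn ℝ univ (proxSq α γ K M W) := by
  refine ⟨convex_univ, fun x _ y _ s t hs ht hst => ?_⟩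
  have h1 := (convexOn_sqNorm hL).2 (mem_univ x.1) (mem_univ y.1) hs ht hst
  have h2 := (convexOn_sqNorm hV).2 (mem_univ x.2.2) (mem_univ y.2.2) hs ht hst
  have h3 := mul_le_mul_of_nonneg_left (add_le_add h1 h2) (show 0 ≤ 1 / α by positivity)
  simp only [proxSq, Prod.fst_add, Prod.snd_add, Prod.smul_fst, Prod.smul_snd, smul_eq_mul]
    at h3 ⊢
  linarith

/-- One sweep of the algorithm satisfies the three-point inequality in the proximal seminorm. -/
lemma sweep_three_point (hα : 0 < α) (hab : a ≤ b) (hM : M.PosDef) (hK : K.IsSymm)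
    (hW : W.IsSymm) (hMW : ∀ x, sqNorm M x ≤ sqNorm W x)
    (hMV : ∀ x, sqNorm M x ≤ sqNorm (γ • (M * W⁻¹ * M)) x) {zt z w : Dual N} {phat : Vec N}
    (hphat : IsMinOn (pObj α K M yd yr zt.1 zt.2.2) univ phat)
    (hlam : IsMinOn (lamObj α β M W phat zt.1 zt.2.2) univ z.1)
    (hp : IsMinOn (pObj α K M yd yr z.1 zt.2.2) univ z.2.1)
    (hmu : IsMinOn (muObj α a b γ M W z.1 z.2.1 zt.2.2) univ z.2.2)
    (hz : z.1 ∈ box (-β) β) (hw : w.1 ∈ box (-β) β) :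
    dualReal α a b K M yd yr z + 1 / 2 * proxSq α γ K M W (w - z)
      ≤ dualReal α a b K M yd yr w + 1 / 2 * proxSq α γ K M W (w - zt) := by
  have hMs := PosDef.isSymm hM
  have hP := posDef_pMat hα hM hK
  have hWi : W⁻¹.IsSymm := by rw [Matrix.IsSymm, transpose_nonsing_inv, hW.eq]
  have hVs : (γ • (M * W⁻¹ * M)).IsSymm := (isSymm_mul_mul hMs hWi).smul γ
  have hLs : (lamMat α K M W).IsSymm :=
    ((isSymm_mul_mul hMs (PosDef.isSymm hP.inv)).add hW).sub hMs
  obtain ⟨l, p, m⟩ := z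
  obtain ⟨lt, pt, mt⟩ := zt
  obtain ⟨wl, wp, wm⟩ := w
  dsimp only at *
  have h1 := pObj_stationary hM hp (wp - p)
  have h2 := sGS_variational hα hM hK hW hphat hlam hp hz hw
  have h3 := muObj_variational hab hMs hVs hmu wm
  -- Here e is the new coupling residual, while e - ε = λ + μ̃ - p is the residual that the λ- and
  -- p-steps saw, with the old μ̃.
  have key := two_block_descent (c := 1 / α) (H := M⁻¹) (R := lamMat α K M W)
    (V := γ • (M * W⁻¹ * M)) (u := K *ᵥ p - M *ᵥ yd) (v := K *ᵥ (wp - p)) (e := l + m - p)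
    (ε := m - mt) (η := l - lt) (r := M *ᵥ yr) (dl := wl - l) (dp := wp - p) (dm := wm - m)
    (g := suppBox a b M wm - suppBox a b M m) (by positivity) hMs hLs hVs
    (PosDef.sqNorm_nonneg hM.inv) (PosDef.sqNorm_nonneg hM)
    (sqNorm_lamMat_nonneg hα hM hK hMW) hMV
    (by
      rw [show l + m - p - (m - mt) = (-1 : ℝ) • (p - l - mt) by module, blf_smul_left]
      linarith)
    (by rwa [show l + m - p - (m - mt) = l + mt - p by abel])
    (by rwa [show l + m - p = m - (p - l) by abel])
  have e1 : K *ᵥ wp - M *ᵥ yd = (K *ᵥ p - M *ᵥ yd) + K *ᵥ (wp - p) := by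
    rw [mulVec_sub]; abel
  have e2 : wl + wm - wp = (l + m - p) + (wl - l + (wm - m) - (wp - p)) := by abel
  have e3 : (M *ᵥ yr) ⬝ᵥ wp = (M *ᵥ yr) ⬝ᵥ p + (M *ᵥ yr) ⬝ᵥ (wp - p) := by
    rw [dotProduct_sub]; ring
  simp only [dualReal, proxSq, Prod.mk_sub_mk, e1, e2, e3, sqNorm_add _ _ hMs,
    sqNorm_add _ _ (PosDef.isSymm hM.inv)]
  rw [sub_add_sub_cancel, sub_add_sub_cancel] at key
  have : 1 / (2 * α) = 1 / 2 * (1 / α) := by rw [one_div_mul_one_div]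
  rw [this]
  linarith

end Convergence

/-! ### Rate and boundedness for abstract matrices -/

section Convergence

variable {N : ℕ} {α β a b γ : ℝ} {K M W : Matrix (Fin N) (Fin N) ℝ} {yd yr : Vec N}

lemma isBounded_box (l u : ℝ) : Bornology.IsBounded (box l u : Set (Vec N)) := by
  refine (Metric.isBounded_Icc (fun _ => l) (fun _ => u)).subset fun x hx => ?_
  exact ⟨fun i => (hx i).1, fun i => (hx i).2⟩

lemma isBounded_setOf_sqNorm_diagonal_le {w : Vec N} (hw : ∀ i, 0 < w i) (c : ℝ) :
    Bornology.IsBounded {x : Vec N | sqNorm (diagonal w) x ≤ c} := by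
  refine (Metric.isBounded_Icc (fun i => -(1 + c / w i)) (fun i => 1 + c / w i)).subset
    fun x hx => ?_
  have key (i : Fin N) : |x i| ≤ 1 + c / w i := by
    have h1 : w i * x i ^ 2 ≤ c := by
      refine le_trans ?_ hx
      rw [sqNorm_diagonal]
      exact Finset.single_le_sum (f := fun i => w i * x i ^ 2)
        (fun j _ => mul_nonneg (hw j).le (sq_nonneg _)) (Finset.mem_univ i)
    have h2 : x i ^ 2 ≤ c / w i := by rw [le_div_iff₀ (hw i)]; linarith
    rw [← sq_abs] at h2
    nlinarith [sq_nonneg (|x i| - 1), abs_nonneg (x i)]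
  exact ⟨fun i => (abs_le.1 (key i)).1, fun i => (abs_le.1 (key i)).2⟩

/-- The starting point is arbitrary, so λ⁰ may lie outside the box and the bounds hold only for k ≥
1. -/
lemma isBounded_range_of_tail {E : Type*} [PseudoMetricSpace E] {z : ℕ → E} {S : Set E}
    (hS : Bornology.IsBounded S) (h : ∀ k, 1 ≤ k → z k ∈ S) : Bornology.IsBounded (range z) := by
  refine (Bornology.isBounded_union.2 ⟨Bornology.isBounded_singleton (x := z 0), hS⟩).subset ?_
  rintro _ ⟨k, rfl⟩
  rcases Nat.eq_zero_or_pos k with rfl | hk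
  · exact Or.inl rfl
  · exact Or.inr (h k hk)

/-- Convergence rate and boundedness of the algorithm, for abstract matrices. -/
theorem convergence {w : Vec N} (hα : 0 < α) (hβ : 0 < β) (hab : a ≤ b) (hγ : 0 < γ)
    (hM : M.PosDef) (hK : K.IsSymm) (hw : ∀ i, 0 < w i) (hWw : W = diagonal w)
    (hMW : ∀ x, sqNorm M x ≤ sqNorm W x) (hWM : ∀ x, sqNorm W x ≤ γ * sqNorm M x)
    {zs : Dual N} (hzs : IsMinOn (dualObj α β a b K M yd yr) univ zs)
    {z : ℕ → Dual N} (hz : IsGenerated α β a b γ K M W yd yr z) :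
    (∀ k : ℕ, 1 ≤ k →
      dualObj α β a b K M yd yr (z k) - dualObj α β a b K M yd yr zs
        ≤ ((4 * tauh α γ K M W (z 0) zs / ((k : ℝ) + 1) ^ 2 : ℝ) : EReal)) ∧
    Bornology.IsBounded (range z) := by
  have hWp : W.PosDef := hWw ▸ PosDef.diagonal hw
  have hMs := PosDef.isSymm hM
  have hMV := sqNorm_le_smul_mul_inv_mul hγ hMs hWp hWM
  have hL := sqNorm_lamMat_nonneg hα hM hK hMW
  have hV : ∀ x, 0 ≤ sqNorm (γ • (M * W⁻¹ * M)) x := fun x =>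
    (PosDef.sqNorm_nonneg hM x).trans (hMV x)
  obtain ⟨zt, phat, t, hzt1, ht1, hrec⟩ := hz
  have ht := fun k hk => (hrec k hk).2.2.2.2.1
  have hzt := fun k hk => (hrec k hk).2.2.2.2.2
  have hbox : ∀ k, 1 ≤ k → (z k).1 ∈ box (-β) β := fun k hk =>
    mem_box_of_isMinOn hβ.le (hrec k hk).2.1
  have hsbox := mem_box_of_isMinOn_dualObj hab hβ.le hzs
  have hlyap := fun k (hk : 1 ≤ k) => lyapunov_le (Q := proxSq α γ K M W)
    (F := dualReal α a b K M yd yr) (C := {z : Dual N | z.1 ∈ box (-β) β}) proxSq_smul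
    (convexOn_dualReal hα hM) hsbox hzt1 ht1 ht hzt hbox (fun k hk w hw' => by
      obtain ⟨h1, h2, h3, h4, -, -⟩ := hrec k hk
      exact sweep_three_point hα hab hM hK (PosDef.isSymm hWp) hMW hMV h1 h2 h3 h4
        (hbox k hk) hw') hk
  have hQ0 : ∀ x, 0 ≤ proxSq α γ K M W x := fun x =>
    mul_nonneg (by positivity) (add_nonneg (hL _) (hV _))
  have hmin : ∀ k, 1 ≤ k → dualReal α a b K M yd yr zs ≤ dualReal α a b K M yd yr (z k) := by
    intro k hk
    have h := isMinOn_iff.1 hzs (z k) (mem_univ _)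
    rwa [dualObj_coe hab hsbox, dualObj_coe hab (hbox k hk), EReal.coe_le_coe_iff] at h
  have hthalf := fun k (hk : 1 ≤ k) => half_le_of_recursion ht1 ht hk
  have hone : ∀ k, 1 ≤ k → 1 ≤ t k := by
    intro k hk
    have hk' : (1 : ℝ) ≤ k := by exact_mod_cast hk
    linarith [hthalf k hk]
  refine ⟨fun k hk => ?_, ?_⟩
  · rw [dualObj_coe hab hsbox, dualObj_coe hab (hbox k hk), ← EReal.coe_sub,
      EReal.coe_le_coe_iff, tauh_eq, le_div_iff₀ (by positivity)]
    have h1 := hlyap k hk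
    have h2 := hQ0 (t k • z k - (t k - 1) • z (k - 1) - zs)
    have h3 : ((k : ℝ) + 1) ^ 2 ≤ 4 * t k ^ 2 := by
      have := pow_le_pow_left₀ (by positivity) (hthalf k hk) 2
      linarith
    have h4 := mul_le_mul_of_nonneg_left h3 (sub_nonneg.2 (hmin k hk))
    linarith
  have hprox : ∀ k, proxSq α γ K M W (z k - zs) ≤ proxSq α γ K M W (z 0 - zs) :=
    seminorm_iterates_le (convexOn_proxSq hα hL hV) hone fun k hk => by
      have h1 := hlyap k hk
      have h2 := mul_nonneg (sq_nonneg (t k)) (sub_nonneg.2 (hmin k hk))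
      linarith
  -- The chain W ≤ γM ≤ γ·(γMW⁻¹M) turns the seminorm bound into a bound on μ in the positive
  -- diagonal form W.
  obtain ⟨C, hC⟩ : ∃ C, ∀ k, ‖(z k).2.2‖ ≤ C := by
    obtain ⟨C, hC⟩ := (isBounded_setOf_sqNorm_diagonal_le hw
      (γ * (α * proxSq α γ K M W (z 0 - zs)))).exists_norm_le
    refine ⟨C + ‖zs.2.2‖, fun k => ?_⟩
    have h1 : sqNorm (diagonal w) ((z k).2.2 - zs.2.2)
        ≤ γ * (α * proxSq α γ K M W (z 0 - zs)) := by
      rw [← hWw]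
      refine (hWM _).trans (mul_le_mul_of_nonneg_left ((hMV _).trans ?_) hγ.le)
      refine le_trans ?_ (mul_le_mul_of_nonneg_left (hprox k) hα.le)
      rw [proxSq, ← mul_assoc, mul_one_div_cancel hα.ne', one_mul]
      exact le_add_of_nonneg_left (hL _)
    calc ‖(z k).2.2‖ = ‖((z k).2.2 - zs.2.2) + zs.2.2‖ := by rw [sub_add_cancel]
      _ ≤ _ := (norm_add_le _ _).trans (add_le_add_left (hC _ h1) _)
  have hC0 : 0 ≤ C := (norm_nonneg _).trans (hC 0)
  -- The extrapolation factor lies in [0, 1], so ‖μ̃‖ ≤ C + 2C.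
  have hmt : ∀ k, 1 ≤ k → ‖(zt k).2.2‖ ≤ 3 * C := by
    intro k hk
    rcases Nat.eq_or_lt_of_le hk with rfl | hk1
    · rw [hzt1]; linarith [hC 0]
    obtain ⟨j, rfl⟩ : ∃ j, k = j + 1 := ⟨k - 1, by omega⟩
    have hj : 1 ≤ j := by omega
    rw [hzt j hj]
    have hr0 : 0 ≤ (t j - 1) / t (j + 1) :=
      div_nonneg (by linarith [hone j hj]) (by linarith [hone (j + 1) hk])
    have hr1 : (t j - 1) / t (j + 1) ≤ 1 := by
      rw [div_le_one (by linarith [hone (j + 1) hk])]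
      have := sq_sub_self_of_recursion (ht j hj)
      nlinarith [hone j hj, hone (j + 1) hk]
    change ‖(z j).2.2 + ((t j - 1) / t (j + 1)) • ((z j).2.2 - (z (j - 1)).2.2)‖ ≤ _
    refine (norm_add_le _ _).trans ?_
    rw [norm_smul, Real.norm_of_nonneg hr0]
    have h1 := norm_sub_le (z j).2.2 (z (j - 1)).2.2
    have h2 := mul_le_mul hr1 h1 (norm_nonneg _) zero_le_one
    linarith [hC j, hC (j - 1)]
  obtain ⟨D, hD⟩ := (isBounded_box (N := N) (-β) β).exists_norm_le
  have hP := posDef_pMat hα hM hK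
  -- The p-solution map: p^k = f(λ^k + μ̃^k), so p^k lies in the continuous image of a compact ball.
  set f : Vec N → Vec N := fun v =>
    (pMat α K M)⁻¹ *ᵥ (M *ᵥ v + α • (K *ᵥ yd - M *ᵥ yr)) with hf
  have hfc : Continuous f := by fun_prop
  have hfb : Bornology.IsBounded (f '' Metric.closedBall 0 (D + 3 * C)) :=
    ((isCompact_closedBall _ _).image hfc).isBounded
  refine isBounded_range_of_tail
    ((isBounded_box (-β) β).prod (hfb.prod (Metric.isBounded_closedBall (x := 0) (r := C))))
    fun k hk => ⟨hbox k hk, ⟨(z k).1 + (zt k).2.2, ?_, ?_⟩, ?_⟩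
  · rw [mem_closedBall_zero_iff]
    exact (norm_add_le _ _).trans (add_le_add (hD _ (hbox k hk)) (hmt k hk))
  · rw [hf]
    dsimp only
    rw [← pMat_mulVec hα hM hK (hrec k hk).2.2.1, mulVec_mulVec, PosDef.inv_mul hP, one_mulVec]
  · rw [mem_closedBall_zero_iff]
    exact hC k

end Convergence

end FEDual

theorem mainTheorem2 {n N : ℕ} (hn : n = 2 ∨ n = 3)
    (Ω : Set (Space n)) (hΩo : IsOpen Ω) (hΩb : Bornology.IsBounded Ω) (hΩc : Convex ℝ Ω)
    (A : Fin n → Fin n → Space n → ℝ) (c₀ : Space n → ℝ) (hL : IsElliptic Ω A c₀)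
    (α β a b : ℝ) (hα : 0 < α) (hβ : 0 < β) (ha : a ≤ 0) (hb : 0 ≤ b)
    (T : Geometry.SimplicialComplex ℝ (Space n)) (hT : IsTriangulation Ω T)
    (node : Fin N → Space n) (φ : Fin N → Space n → ℝ) (hφ : IsNodalBasis T node φ)
    (fd fr : Space n → ℝ) (hfd : MemLp fd 2 (volume.restrict Ω))
    (hfr : MemLp fr 2 (volume.restrict Ω))
    (yd yr : Vec N) (hyd : IsProjection Ω φ fd yd) (hyr : IsProjection Ω φ fr yr)
    (K M W : Matrix (Fin N) (Fin N) ℝ)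
    (hK : K = stiffness Ω A c₀ φ) (hM : M = mass T φ) (hW : W = lumpedMass T φ)
    (zs : Dual N) (hzs : IsMinOn (dualObj α β a b K M yd yr) univ zs)
    (z : ℕ → Dual N) (hz : IsGenerated α β a b (gam n) K M W yd yr z) :
    (∀ k : ℕ, 1 ≤ k →
      dualObj α β a b K M yd yr (z k) - dualObj α β a b K M yd yr zs
        ≤ ((4 * tauh α (gam n) K M W (z 0) zs / ((k : ℝ) + 1) ^ 2 : ℝ) : EReal)) ∧
    Bornology.IsBounded (range z) := by
  subst hK hM hW
  -- γ is exactly the constant of the mass comparison on an n-simplex, namely its n + 1 vertices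
  -- plus one.
  have hγ : gam n = n + 2 := by
    rcases hn with rfl | rfl <;> norm_num [gam]
  have hw : ∀ i, 0 < ∫ x in meshDomain T, φ i x := hφ.setIntegral_pos hT
  have hWM := sqNorm_lumpedMass_le_mass hT hφ
  have hWp : (lumpedMass T φ).PosDef := PosDef.diagonal hw
  refine convergence hα hβ (ha.trans hb) (by rw [hγ]; positivity)
    (posDef_of_sqNorm_pos (mass_isSymm T φ) fun x hx => ?_) (stiffness_isSymm hL φ) hw rfl
    (sqNorm_mass_le_lumpedMass hT hφ) (fun x => hγ ▸ hWM x) hzs hz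
  -- M inherits definiteness from the positive diagonal W through W ≤ (n+2)M, so no linear
  -- independence argument is needed.
  have h1 : 0 < sqNorm (lumpedMass T φ) x := by
    have := hWp.dotProduct_mulVec_pos hx
    rwa [star_trivial] at this
  exact pos_of_mul_pos_right (h1.trans_le (hWM x)) (by positivity)
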